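/- Let $a\le b$, let $n,p,q\ge 0$ be integers, and let $L_2^n[a,b]$ be the space of square-integrable functions $[a,b]\to\mathbb{R}^n$. For matrix-valued functions $R_0:[a,b]\to\mathbb{R}^{n\times n}$ and $R_1,R_2:[a,b]^2\to\mathbb{R}^{n\times n}$ write $$(\mathcal{P}_{\{R_0,R_1,R_2\}}\mathbf{x})(s)=R_0(s)\mathbf{x}(s)+\int_a^s R_1(s,\theta)\mathbf{x}(\theta)\,d\theta+\int_s^b R_2(s,\theta)\mathbf{x}(\theta)\,d\theta$$ for the corresponding 3-PI operator on $L_2^n[a,b]$. Suppose that $R_0(s)$ is invertible for every $s\in[a,b]$, that the entries of $R_0$ and of $R_0^{-1}$ are measurable and essentially bounded on $[a,b]$, and that $$R_0(s)^{-1}R_i(s,\theta)=-F_i(s)G_i(\theta),\qquad s,\theta\in[a,b],\ i\in\{1,2\},$$ where $F_1,G_1,F_2,G_2$ are square-integrable functions on $[a,b]$ with values in $\mathbb{R}^{n\times p},\mathbb{R}^{p\times n},\mathbb{R}^{n\times q},\mathbb{R}^{q\times n}$ respectively. Put $$A(t)=\begin{bmatrix}G_1(t)F_1(t)&G_1(t)F_2(t)\\-G_2(t)F_1(t)&-G_2(t)F_2(t)\end{bmatrix}.$$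 Then there are unique functions $U,V:[a,b]\to\mathbb{R}^{(p+q)\times(p+q)}$ with $$U(s)=I+\int_a^sA(t)U(t)\,dt,\qquad V(t)=I-\int_a^tV(s)A(s)\,ds .$$ Partition $U=\begin{bmatrix}U_{11}&U_{12}\\U_{21}&U_{22}\end{bmatrix}$ with $U_{11}(s)\in\mathbb{R}^{p\times p}$ and $U_{22}(s)\in\mathbb{R}^{q\times q}$. Then $\mathcal{P}_{\{R_0,R_1,R_2\}}$ is a bounded operator on $L_2^n[a,b]$, and it is (boundedly) invertible if and only if the matrix $U_{22}(b)$ is invertible. In that case $$\left(\mathcal{P}_{\{R_0,R_1,R_2\}}\right)^{-1}=\mathcal{P}_{\{\hat R_0,\hat R_1,\hat R_2\}},\qquad \hat R_0(s)=R_0(s)^{-1},\quad \hat R_i(s,\theta)=L_i(s,\theta)R_0(\theta)^{-1},\ i\in\{1,2\},$$ where $$L_2(s,t)=-\begin{bmatrix}F_1(s)&F_2(s)\end{bmatrix}U(s)PV(t)\begin{bmatrix}G_1(t)\\-G_2(t)\end{bmatrix},\qquad P=\begin{bmatrix}0&0\\U_{22}(b)^{-1}U_{21}(b)&I_q\end{bmatrix},$$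 $$L_1(s,t)=\begin{bmatrix}F_1(s)&F_2(s)\end{bmatrix}U(s)V(t)\begin{bmatrix}G_1(t)\\-G_2(t)\end{bmatrix}+L_2(s,t).$$ -/

import Mathlib

open MeasureTheory Set

noncomputable section

namespace ThreePI

/-- The Hilbert space `L₂ⁿ[a,b]` of square-integrable functions `[a,b] → ℝⁿ`. -/
abbrev L2 (n : ℕ) (a b : ℝ) : Type :=
  Lp (EuclideanSpace ℝ (Fin n)) 2 (volume.restrict (Icc a b))

/-- The matrix-vector product on Euclidean space. -/
def act {n : ℕ} (M : Matrix (Fin n) (Fin n) ℝ) (v : EuclideanSpace ℝ (Fin n)) :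
    EuclideanSpace ℝ (Fin n) :=
  WithLp.toLp 2 (M.mulVec v.ofLp)

/-- All entries of the matrix-valued function `M` are (a.e. measurable and) of class `L^r` on
`[a,b]`. -/
def EntriesMemLp {l m : Type} (r : ENNReal) (a b : ℝ) (M : ℝ → Matrix l m ℝ) : Prop :=
  ∀ i j, MemLp (fun s => M s i j) r (volume.restrict (Icc a b))

/-- The bounded operator `T` on `L₂ⁿ[a,b]` is the 3-PI operator with parameters `R₀, R₁, R₂`:
for every `x`, for a.e. `s ∈ [a,b]`, both integrals exist and
`(T x)(s) = R₀(s) x(s) + ∫_a^s R₁(s,θ) x(θ) dθ + ∫_s^b R₂(s,θ) x(θ) dθ`. -/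
def IsThreePI {n : ℕ} {a b : ℝ} (R₀ : ℝ → Matrix (Fin n) (Fin n) ℝ)
    (R₁ R₂ : ℝ → ℝ → Matrix (Fin n) (Fin n) ℝ) (T : L2 n a b →L[ℝ] L2 n a b) : Prop :=
  ∀ x : L2 n a b, ∀ᵐ s ∂(volume.restrict (Icc a b)),
    IntervalIntegrable (fun θ => act (R₁ s θ) (x θ)) volume a s ∧
    IntervalIntegrable (fun θ => act (R₂ s θ) (x θ)) volume s b ∧
    (T x) s = act (R₀ s) (x s) + (∫ θ in a..s, act (R₁ s θ) (x θ))
      + ∫ θ in s..b, act (R₂ s θ) (x θ)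

section Construction

variable {n p q : ℕ}

/-- The row `[F₁(s) F₂(s)]`. -/
def rowF (F₁ : ℝ → Matrix (Fin n) (Fin p) ℝ) (F₂ : ℝ → Matrix (Fin n) (Fin q) ℝ) (s : ℝ) :
    Matrix (Fin n) (Fin p ⊕ Fin q) ℝ :=
  Matrix.fromCols (F₁ s) (F₂ s)

/-- The column `[G₁(t); -G₂(t)]`. -/
def colG (G₁ : ℝ → Matrix (Fin p) (Fin n) ℝ) (G₂ : ℝ → Matrix (Fin q) (Fin n) ℝ) (t : ℝ) :
    Matrix (Fin p ⊕ Fin q) (Fin n) ℝ :=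
  Matrix.fromRows (G₁ t) (-(G₂ t))

/-- The coefficient matrix `[G₁F₁, G₁F₂; -G₂F₁, -G₂F₂]`. -/
def coeff (F₁ : ℝ → Matrix (Fin n) (Fin p) ℝ) (G₁ : ℝ → Matrix (Fin p) (Fin n) ℝ)
    (F₂ : ℝ → Matrix (Fin n) (Fin q) ℝ) (G₂ : ℝ → Matrix (Fin q) (Fin n) ℝ) (t : ℝ) :
    Matrix (Fin p ⊕ Fin q) (Fin p ⊕ Fin q) ℝ :=
  Matrix.fromBlocks (G₁ t * F₁ t) (G₁ t * F₂ t) (-(G₂ t * F₁ t)) (-(G₂ t * F₂ t))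

/-- `U` is the fundamental matrix of `z' = A z` on `[a,b]`, normalized at `a`:
`U(s) = I + ∫_a^s A(t) U(t) dt` for all `s ∈ [a,b]`, the integral existing entrywise. -/
def IsFundamental (a b : ℝ) (A U : ℝ → Matrix (Fin p ⊕ Fin q) (Fin p ⊕ Fin q) ℝ) : Prop :=
  ∀ i j, IntervalIntegrable (fun t => (A t * U t) i j) volume a b ∧
    ∀ s ∈ Icc a b, U s i j =
      (1 : Matrix (Fin p ⊕ Fin q) (Fin p ⊕ Fin q) ℝ) i j + ∫ t in a..s, (A t * U t) i j

/-- `V` solves the adjoint equation `V(t) = I - ∫_a^t V(s) A(s) ds` for all `t ∈ [a,b]`, the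
integral existing entrywise. -/
def IsAdjointFundamental (a b : ℝ) (A V : ℝ → Matrix (Fin p ⊕ Fin q) (Fin p ⊕ Fin q) ℝ) :
    Prop :=
  ∀ i j, IntervalIntegrable (fun s => (V s * A s) i j) volume a b ∧
    ∀ t ∈ Icc a b, V t i j =
      (1 : Matrix (Fin p ⊕ Fin q) (Fin p ⊕ Fin q) ℝ) i j - ∫ s in a..t, (V s * A s) i j

/-- The matrix `P = [0, 0; U₂₂(b)⁻¹ U₂₁(b), I]`, as a function of `U(b)`. -/
def projP (Ub : Matrix (Fin p ⊕ Fin q) (Fin p ⊕ Fin q) ℝ) :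
    Matrix (Fin p ⊕ Fin q) (Fin p ⊕ Fin q) ℝ :=
  Matrix.fromBlocks 0 0 (Ub.toBlocks₂₂⁻¹ * Ub.toBlocks₂₁) 1

/-- `L₂(s,t) = -[F₁(s) F₂(s)] U(s) P V(t) [G₁(t); -G₂(t)]`. -/
def kerL₂ (b : ℝ) (F₁ : ℝ → Matrix (Fin n) (Fin p) ℝ) (G₁ : ℝ → Matrix (Fin p) (Fin n) ℝ)
    (F₂ : ℝ → Matrix (Fin n) (Fin q) ℝ) (G₂ : ℝ → Matrix (Fin q) (Fin n) ℝ)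
    (U V : ℝ → Matrix (Fin p ⊕ Fin q) (Fin p ⊕ Fin q) ℝ) (s t : ℝ) :
    Matrix (Fin n) (Fin n) ℝ :=
  -(rowF F₁ F₂ s * U s * projP (U b) * V t * colG G₁ G₂ t)

/-- `L₁(s,t) = [F₁(s) F₂(s)] U(s) V(t) [G₁(t); -G₂(t)] + L₂(s,t)`. -/
def kerL₁ (b : ℝ) (F₁ : ℝ → Matrix (Fin n) (Fin p) ℝ) (G₁ : ℝ → Matrix (Fin p) (Fin n) ℝ)
    (F₂ : ℝ → Matrix (Fin n) (Fin q) ℝ) (G₂ : ℝ → Matrix (Fin q) (Fin n) ℝ)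
    (U V : ℝ → Matrix (Fin p ⊕ Fin q) (Fin p ⊕ Fin q) ℝ) (s t : ℝ) :
    Matrix (Fin n) (Fin n) ℝ :=
  rowF F₁ F₂ s * U s * V t * colG G₁ G₂ t + kerL₂ b F₁ G₁ F₂ G₂ U V s t

end Construction

end ThreePI

end

/-! Put F = [F₁ F₂], B = [G₁; -G₂], A = B F and y = R₀⁻¹ f. The factorization turns T x = f into x -
F z = y, where z(s) = (∫_a^s G₁ x, ∫_s^b G₂ x) is the `state`. Since z' = B x, this is the two-point
boundary value problem z' = A z + B y, with the first block of z vanishing at a and the second at b.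
Variation of constants gives z(s) = U(s)(c + ∫_a^s V B y) with V = U⁻¹ and c = (0, c₂).

If U₂₂(b) is invertible, the condition at b forces c = -P ∫_a^b V B y
(`mulVec_add_inr_eq_zero_iff`). The resulting equivalence `eq_sub_state_iff` yields T S = 1 and S T
= 1 from its two directions, and splitting ∫_a^b at s produces the kernels L₁ and L₂. If U₂₂(b) is
singular, a null vector c₂ ≠ 0 gives z = U (0, c₂), and x = F z is a nonzero element of the kernel
of T (`exists_eq_state_of_not_isUnit`).

The matrix A is merely integrable, so differential equations are read as integral equations through
`IsPrimitiveOn`, whose product rule `IsPrimitiveOn.mul` carries the calculus. Existence comes from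
the Neumann series of a Volterra operator. Boundedness on L² follows from Hölder's inequality,
because all kernels are separable. -/

namespace ThreePI

/-- `f` is, on `[a,b]`, an indefinite integral of the integrable function `f'`. -/
def IsPrimitiveOn (a b : ℝ) (f f' : ℝ → ℝ) : Prop :=
  IntervalIntegrable f' volume a b ∧ ∀ s ∈ Icc a b, f s = f a + ∫ t in a..s, f' t

/-! ### Calculus of indefinite integrals. -/

namespace IsPrimitiveOn

variable {a b : ℝ} {f f' g g' : ℝ → ℝ}

theorem const (c : ℝ) : IsPrimitiveOn a b (fun _ => c) (fun _ => 0) :=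
  ⟨by simp, by simp⟩

theorem of_eq (c : ℝ) (hab : a ≤ b) (hf' : IntervalIntegrable f' volume a b)
    (h : ∀ s ∈ Icc a b, f s = c + ∫ t in a..s, f' t) : IsPrimitiveOn a b f f' := by
  refine ⟨hf', fun s hs => ?_⟩
  rw [h s hs, h a (left_mem_Icc.2 hab)]
  simp

theorem integral (hf' : IntervalIntegrable f' volume a b) :
    IsPrimitiveOn a b (fun s => ∫ t in a..s, f' t) f' :=
  ⟨hf', by simp⟩

theorem intervalIntegrable_of_mem (hf : IsPrimitiveOn a b f f') {s : ℝ} (hs : s ∈ Icc a b) :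
    IntervalIntegrable f' volume a s :=
  hf.1.mono_set (by
    rw [uIcc_of_le hs.1, uIcc_of_le (hs.1.trans hs.2)]; exact Icc_subset_Icc_right hs.2)

theorem continuousOn (hf : IsPrimitiveOn a b f f') : ContinuousOn f (Icc a b) := by
  rcases le_or_gt a b with hab | hab
  · have h := intervalIntegral.continuousOn_primitive_interval' hf.1 left_mem_uIcc
    rw [uIcc_of_le hab] at h
    exact (continuousOn_const.add h).congr hf.2
  · simp [Icc_eq_empty (not_le.2 hab)]

theorem congr_ae (hab : a ≤ b) (hf : IsPrimitiveOn a b f f')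
    (h : ∀ᵐ t ∂(volume.restrict (Icc a b)), f' t = g' t) : IsPrimitiveOn a b f g' := by
  have h' := (ae_restrict_iff' measurableSet_Icc).1 h
  refine ⟨hf.1.congr_ae ?_, fun s hs => ?_⟩
  · rw [Filter.EventuallyEq, ae_restrict_iff' measurableSet_uIoc, uIoc_of_le hab]
    filter_upwards [h'] with t ht hm using ht (Ioc_subset_Icc_self hm)
  · rw [hf.2 s hs]
    congr 1
    refine intervalIntegral.integral_congr_ae ?_
    rw [uIoc_of_le hs.1]
    filter_upwards [h'] with t ht hm using ht ⟨hm.1.le, hm.2.trans hs.2⟩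

theorem add (hf : IsPrimitiveOn a b f f') (hg : IsPrimitiveOn a b g g') :
    IsPrimitiveOn a b (fun s => f s + g s) (fun s => f' s + g' s) := by
  refine ⟨hf.1.add hg.1, fun s hs => ?_⟩
  simp only []
  rw [intervalIntegral.integral_add (hf.intervalIntegrable_of_mem hs)
    (hg.intervalIntegrable_of_mem hs), hf.2 s hs, hg.2 s hs]
  ring

theorem sum {ι : Type*} (S : Finset ι) {f f' : ι → ℝ → ℝ}
    (hf : ∀ i ∈ S, IsPrimitiveOn a b (f i) (f' i)) :
    IsPrimitiveOn a b (fun s => ∑ i ∈ S, f i s) (fun s => ∑ i ∈ S, f' i s) := by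
  classical
  induction S using Finset.induction_on with
  | empty => simpa using const 0
  | insert i S hi ih =>
    simp only [Finset.sum_insert hi]
    exact (hf i (by simp)).add (ih fun j hj => hf j (by simp [hj]))

theorem mul (hab : a ≤ b) (hf : IsPrimitiveOn a b f f') (hg : IsPrimitiveOn a b g g') :
    IsPrimitiveOn a b (fun s => f s * g s) (fun s => f' s * g s + f s * g' s) := by
  have hu : uIcc a b = Icc a b := uIcc_of_le hab
  refine ⟨(hf.1.mul_continuousOn (hu ▸ hg.continuousOn)).add
    (hg.1.continuousOn_mul (hu ▸ hf.continuousOn)), fun s hs => ?_⟩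
  have hsub : uIcc a s ⊆ Icc a b := by
    rw [uIcc_of_le hs.1]; exact Icc_subset_Icc_right hs.2
  -- Integration by parts is applied to f(a) + ∫ f' and g(a) + ∫ g'. They agree with f and g on [a,
  -- s], are absolutely continuous, and have derivatives f' and g' a.e. by Lebesgue differentiation.
  have ac : ∀ {f f' : ℝ → ℝ}, IsPrimitiveOn a b f f' →
      AbsolutelyContinuousOnInterval (fun s => f a + ∫ t in a..s, f' t) a s := fun h =>
    (LipschitzOnWith.absolutelyContinuousOnInterval
      (LipschitzWith.const _).lipschitzOnWith).add
      ((h.intervalIntegrable_of_mem hs).absolutelyContinuousOnInterval_intervalIntegral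
        left_mem_uIcc)
  have key := (ac hf).integral_deriv_mul_eq_sub (ac hg)
  rw [← hf.2 s hs, ← hg.2 s hs] at key
  simp only [intervalIntegral.integral_same, add_zero] at key
  rw [← sub_eq_iff_eq_add', ← key]
  refine intervalIntegral.integral_congr_ae ?_
  filter_upwards [(hf.intervalIntegrable_of_mem hs).ae_hasDerivAt_integral,
    (hg.intervalIntegrable_of_mem hs).ae_hasDerivAt_integral] with t h1 h2 ht
  have ht := uIoc_subset_uIcc ht
  rw [((h1 ht a left_mem_uIcc).const_add (f a)).deriv,
    ((h2 ht a left_mem_uIcc).const_add (g a)).deriv, ← hf.2 t (hsub ht), ← hg.2 t (hsub ht)]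

end IsPrimitiveOn

end ThreePI

namespace ThreePI

/-! ### Entrywise product rules, powers and matrix bounds. -/

section Products

variable {l m k : Type*} [Fintype m] {a b : ℝ}

theorem isPrimitiveOn_matrix_mul (hab : a ≤ b) {M M' : ℝ → Matrix l m ℝ} {N N' : ℝ → Matrix m k ℝ}
    (hM : ∀ i j, IsPrimitiveOn a b (fun s => M s i j) (fun s => M' s i j))
    (hN : ∀ i j, IsPrimitiveOn a b (fun s => N s i j) (fun s => N' s i j)) (i : l) (j : k) :
    IsPrimitiveOn a b (fun s => (M s * N s) i j) (fun s => (M' s * N s + M s * N' s) i j) := by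
  simp only [Matrix.add_apply, Matrix.mul_apply, ← Finset.sum_add_distrib]
  exact IsPrimitiveOn.sum _ fun r _ => (hM i r).mul hab (hN r j)

theorem isPrimitiveOn_mulVec (hab : a ≤ b) {M M' : ℝ → Matrix l m ℝ} {z z' : ℝ → m → ℝ}
    (hM : ∀ i j, IsPrimitiveOn a b (fun s => M s i j) (fun s => M' s i j))
    (hz : ∀ j, IsPrimitiveOn a b (fun s => z s j) (fun s => z' s j)) (i : l) :
    IsPrimitiveOn a b (fun s => (M s).mulVec (z s) i)
      (fun s => ((M' s).mulVec (z s) + (M s).mulVec (z' s)) i) := by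
  simp only [Pi.add_apply, Matrix.mulVec, dotProduct, ← Finset.sum_add_distrib]
  exact IsPrimitiveOn.sum _ fun r _ => (hM i r).mul hab (hz r)

end Products

theorem IsPrimitiveOn.pow_succ_div_factorial {a b : ℝ} (hab : a ≤ b) {f f' : ℝ → ℝ}
    (hf : IsPrimitiveOn a b f f') (n : ℕ) :
    IsPrimitiveOn a b (fun s => f s ^ (n + 1) / (n + 1).factorial)
      (fun s => f' s * (f s ^ n / n.factorial)) := by
  induction n with
  | zero => simpa using hf
  | succ n ih =>
    -- Read f^(n+2)/(n+2)! as (n+2)⁻¹ · f · f^(n+1)/(n+1)!. The product rule gives 1 + (n+1) copies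
    -- of the wanted derivative, which the constant cancels.
    have h := (IsPrimitiveOn.const ((n + 1 + 1 : ℝ)⁻¹)).mul hab (hf.mul hab ih)
    convert h using 2 with s s
    · rw [Nat.factorial_succ (n + 1), pow_succ' _ (n + 1)]
      push_cast
      field_simp
    · rw [Nat.factorial_succ n, pow_succ' _ n]
      push_cast
      field_simp
      ring

theorem intervalIntegrable_finset_sum {ι : Type*} (S : Finset ι) {a b : ℝ} {f : ι → ℝ → ℝ}
    (h : ∀ i ∈ S, IntervalIntegrable (f i) volume a b) :
    IntervalIntegrable (fun t => ∑ i ∈ S, f i t) volume a b := by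
  have := IntervalIntegrable.sum S h
  rwa [Finset.sum_fn] at this

/-- The sum of the absolute values of the entries of a matrix. -/
def absSum {l m : Type*} [Fintype l] [Fintype m] (M : Matrix l m ℝ) : ℝ :=
  ∑ i, ∑ j, |M i j|

theorem absSum_nonneg {l m : Type*} [Fintype l] [Fintype m] (M : Matrix l m ℝ) :
    0 ≤ absSum M :=
  Finset.sum_nonneg fun _ _ => Finset.sum_nonneg fun _ _ => abs_nonneg _

theorem abs_mulVec_le {l m : Type*} [Fintype l] [Fintype m] (M : Matrix l m ℝ) (v : m → ℝ) (i : l) :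
    |M.mulVec v i| ≤ absSum M * ‖v‖ := by
  calc |M.mulVec v i| ≤ ∑ j, |M i j * v j| := Finset.abs_sum_le_sum_abs _ _
    _ ≤ ∑ j, |M i j| * ‖v‖ := by
        refine Finset.sum_le_sum fun j _ => ?_
        rw [abs_mul]
        exact mul_le_mul_of_nonneg_left (norm_le_pi_norm v j) (abs_nonneg _)
    _ = (∑ j, |M i j|) * ‖v‖ := by rw [Finset.sum_mul]
    _ ≤ _ := mul_le_mul_of_nonneg_right
        (Finset.single_le_sum (f := fun i => ∑ j, |M i j|)
          (fun i _ => Finset.sum_nonneg fun j _ => abs_nonneg _) (Finset.mem_univ i))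
        (norm_nonneg _)

/-! ### Existence for linear systems with integrable coefficients. -/

section Existence

variable {m : Type*} [Fintype m] {a b : ℝ} {A : ℝ → Matrix m m ℝ}

theorem intervalIntegrable_mulVec (hab : a ≤ b)
    (hA : ∀ i j, IntervalIntegrable (fun t => A t i j) volume a b) {z : ℝ → m → ℝ}
    (hz : ∀ j, ContinuousOn (fun t => z t j) (Icc a b)) (i : m) :
    IntervalIntegrable (fun t => (A t).mulVec (z t) i) volume a b := by
  simp only [Matrix.mulVec, dotProduct]
  refine intervalIntegrable_finset_sum (f := fun j t => A t i j * z t j) _ fun j _ => ?_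
  exact (hA i j).mul_continuousOn (by simpa [uIcc_of_le hab] using hz j)

theorem intervalIntegrable_mulVec_projIcc (hab : a ≤ b)
    (hA : ∀ i j, IntervalIntegrable (fun t => A t i j) volume a b)
    (z : C(Icc a b, m → ℝ)) (i : m) :
    IntervalIntegrable (fun t => (A t).mulVec (z (projIcc a b hab t)) i) volume a b :=
  intervalIntegrable_mulVec hab hA (z := fun t => z (projIcc a b hab t))
    (fun j => ((continuous_apply j).comp (z.continuous.comp continuous_projIcc)).continuousOn) i

/-- The Volterra operator `z ↦ ∫_a^s A(t) z(t) dt` on continuous functions. -/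
noncomputable def volterra (hab : a ≤ b)
    (hA : ∀ i j, IntervalIntegrable (fun t => A t i j) volume a b) :
    C(Icc a b, m → ℝ) →ₗ[ℝ] C(Icc a b, m → ℝ) where
  toFun z := ⟨fun s i => ∫ t in a..s, (A t).mulVec (z (projIcc a b hab t)) i, by
    refine continuous_pi fun i => ?_
    have h := (IsPrimitiveOn.integral
      (intervalIntegrable_mulVec_projIcc hab hA z i)).continuousOn
    exact continuousOn_iff_continuous_domRestrict.1 h⟩
  map_add' z w := by
    ext s i
    simp only [ContinuousMap.add_apply, Matrix.mulVec_add, Pi.add_apply, ContinuousMap.coe_mk]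
    exact intervalIntegral.integral_add
      ((IsPrimitiveOn.integral
        (intervalIntegrable_mulVec_projIcc hab hA z i)).intervalIntegrable_of_mem s.2)
      ((IsPrimitiveOn.integral
        (intervalIntegrable_mulVec_projIcc hab hA w i)).intervalIntegrable_of_mem s.2)
  map_smul' c z := by
    ext s i
    simp [Matrix.mulVec_smul]

theorem intervalIntegrable_sum_abs (hA : ∀ i j, IntervalIntegrable (fun t => A t i j) volume a b) :
    IntervalIntegrable (fun t => absSum (A t)) volume a b :=
  intervalIntegrable_finset_sum (f := fun i t => ∑ j, |A t i j|) _ fun i _ =>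
    intervalIntegrable_finset_sum (f := fun j t => |A t i j|) _ fun j _ => (hA i j).abs

/-- Domination by a function φ instead of a constant makes the estimate iterable: constant φ gives
continuity of the operator, and φ = ‖z‖ αⁿ/n! with α(t) = ∫_a^t `absSum` A gives the factorial decay
of its powers. -/
theorem norm_volterra_apply_le (hab : a ≤ b)
    (hA : ∀ i j, IntervalIntegrable (fun t => A t i j) volume a b) (z : C(Icc a b, m → ℝ))
    {φ : ℝ → ℝ} (hφ : IntervalIntegrable (fun t => absSum (A t) * φ t) volume a b)
    (h : ∀ t : Icc a b, ‖z t‖ ≤ φ t) (s : Icc a b) :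
    ‖volterra hab hA z s‖ ≤ ∫ t in a..s, absSum (A t) * φ t := by
  have hφs := (IsPrimitiveOn.integral hφ).intervalIntegrable_of_mem s.2
  have hle : ∀ t ∈ Icc a (s : ℝ), ∀ i, ‖(A t).mulVec (z (projIcc a b hab t)) i‖
      ≤ absSum (A t) * φ t := by
    intro t ht i
    have htb : t ∈ Icc a b := ⟨ht.1, ht.2.trans s.2.2⟩
    refine (abs_mulVec_le _ _ i).trans (mul_le_mul_of_nonneg_left ?_ ?_)
    · have := h ⟨t, htb⟩
      rwa [projIcc_of_mem hab htb]
    · exact absSum_nonneg _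
  refine (pi_norm_le_iff_of_nonneg ?_).2 fun i => ?_
  · refine intervalIntegral.integral_nonneg s.2.1 fun t ht => ?_
    exact mul_nonneg (absSum_nonneg _)
      ((norm_nonneg _).trans (h ⟨t, ht.1, ht.2.trans s.2.2⟩))
  · exact intervalIntegral.norm_integral_le_of_norm_le s.2.1
      (Filter.Eventually.of_forall fun t ht => hle t (Ioc_subset_Icc_self ht) i) hφs

theorem continuous_volterra (hab : a ≤ b)
    (hA : ∀ i j, IntervalIntegrable (fun t => A t i j) volume a b) :
    Continuous (volterra hab hA) := by
  have hα := intervalIntegrable_sum_abs hA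
  refine AddMonoidHomClass.continuous_of_bound (volterra hab hA)
    (∫ t in a..b, absSum (A t)) fun z => ?_
  have hnn : ∀ t, 0 ≤ absSum (A t) := fun t => absSum_nonneg _
  refine (ContinuousMap.norm_le _ (mul_nonneg
    (intervalIntegral.integral_nonneg hab fun t _ => hnn t) (norm_nonneg _))).2 fun s => ?_
  refine (norm_volterra_apply_le hab hA z (φ := fun _ => ‖z‖) (hα.mul_const _)
    (fun t => z.norm_coe_le_norm t) s).trans ?_
  rw [intervalIntegral.integral_mul_const]
  refine mul_le_mul_of_nonneg_right ?_ (norm_nonneg _)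
  exact intervalIntegral.integral_mono_interval le_rfl s.2.1 s.2.2
    (Filter.Eventually.of_forall hnn) hα

theorem norm_volterra_pow_apply_le (hab : a ≤ b)
    (hA : ∀ i j, IntervalIntegrable (fun t => A t i j) volume a b) (z : C(Icc a b, m → ℝ))
    (n : ℕ) (s : Icc a b) :
    ‖(volterra hab hA ^ n) z s‖ ≤
      ‖z‖ * ((∫ t in a..s, absSum (A t)) ^ n / n.factorial) := by
  have hα := IsPrimitiveOn.integral (intervalIntegrable_sum_abs hA)
  induction n generalizing s with
  | zero => simpa using z.norm_coe_le_norm s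
  | succ n ih =>
    rw [pow_succ', Module.End.mul_apply]
    have hp := (IsPrimitiveOn.const ‖z‖).mul hab (hα.pow_succ_div_factorial hab n)
    -- The product rule with the constant factor ‖z‖ leaves a term 0 · (…); the integrand is brought
    -- into that shape.
    have heq : (fun t => absSum (A t) *
        (‖z‖ * ((∫ r in a..t, absSum (A r)) ^ n / n.factorial))) =
        fun t => 0 * ((∫ r in a..t, absSum (A r)) ^ (n + 1) / (n + 1).factorial)
          + ‖z‖ * (absSum (A t) *
            ((∫ r in a..t, absSum (A r)) ^ n / n.factorial)) := by
      funext t; ring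
    refine (norm_volterra_apply_le hab hA _ (φ := fun t => ‖z‖ *
      ((∫ r in a..t, absSum (A r)) ^ n / n.factorial)) ?_ (fun t => ih t) s).trans ?_
    · rw [heq]; exact hp.1
    · rw [heq]
      have := hp.2 s s.2
      simp only [intervalIntegral.integral_same] at this
      simp [this]

/-- Existence for linear systems with integrable coefficients. -/
theorem exists_isPrimitiveOn_mulVec (hab : a ≤ b)
    (hA : ∀ i j, IntervalIntegrable (fun t => A t i j) volume a b) (c : m → ℝ) :
    ∃ z : ℝ → m → ℝ, z a = c ∧
      ∀ i, IsPrimitiveOn a b (fun s => z s i) (fun s => (A s).mulVec (z s) i) := by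
  set K := volterra hab hA
  set u : ℕ → C(Icc a b, m → ℝ) := fun n => (K ^ n) (ContinuousMap.const _ c)
  set α : ℝ := ∫ t in a..b, absSum (A t)
  have hnn : ∀ t, 0 ≤ absSum (A t) := fun t => absSum_nonneg _
  have hα0 : 0 ≤ α := intervalIntegral.integral_nonneg hab fun t _ => hnn t
  have hu : Summable u := by
    refine Summable.of_norm_bounded (g := fun n => ‖ContinuousMap.const (Icc a b) c‖ *
      (α ^ n / n.factorial)) ((Real.summable_pow_div_factorial α).mul_left _) fun n => ?_
    refine (ContinuousMap.norm_le _ (by positivity)).2 fun s => ?_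
    refine (norm_volterra_pow_apply_le hab hA _ n s).trans ?_
    gcongr
    · exact intervalIntegral.integral_nonneg s.2.1 fun t _ => hnn t
    · exact intervalIntegral.integral_mono_interval le_rfl s.2.1 s.2.2
        (Filter.Eventually.of_forall hnn) (intervalIntegrable_sum_abs hA)
  set w := ∑' n, u n
  -- Neumann series: continuity moves K through the sum, and shifting the index gives ∑ Kⁿ c = c + K
  -- ∑ Kⁿ c.
  have hw : w = ContinuousMap.const _ c + K w := by
    have hK : K w = ∑' n, K (u n) :=
      (⟨K, continuous_volterra hab hA⟩ : C(Icc a b, m → ℝ) →L[ℝ] _).map_tsum hu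
    rw [hK, show w = ∑' n, u n from rfl, hu.tsum_eq_zero_add]
    congr 1
    refine tsum_congr fun n => ?_
    simp only [u, pow_succ', Module.End.mul_apply]
  have hz : ∀ s ∈ Icc a b, ∀ i, w (projIcc a b hab s) i =
      c i + ∫ t in a..s, (A t).mulVec (w (projIcc a b hab t)) i := by
    intro s hs i
    conv_lhs => rw [hw]
    rw [projIcc_of_mem hab hs]
    rfl
  refine ⟨fun s => w (projIcc a b hab s), ?_, fun i => ?_⟩
  · funext i
    simpa using hz a (left_mem_Icc.2 hab) i
  · exact IsPrimitiveOn.of_eq (c i) hab (intervalIntegrable_mulVec_projIcc hab hA w i)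
      fun s hs => hz s hs i

end Existence

end ThreePI

namespace ThreePI

/-! ### Fundamental matrices and variation of constants. -/

section Fundamental

variable {p q : ℕ} {a b : ℝ} {A U V : ℝ → Matrix (Fin p ⊕ Fin q) (Fin p ⊕ Fin q) ℝ}

theorem IsFundamental.left_eq_one (hab : a ≤ b) (hU : IsFundamental a b A U) : U a = 1 := by
  ext i j
  simpa using (hU i j).2 a (left_mem_Icc.2 hab)

theorem IsFundamental.isPrimitiveOn (hab : a ≤ b) (hU : IsFundamental a b A U) (i j) :
    IsPrimitiveOn a b (fun s => U s i j) (fun s => (A s * U s) i j) :=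
  IsPrimitiveOn.of_eq _ hab (hU i j).1 (hU i j).2

theorem IsAdjointFundamental.left_eq_one (hab : a ≤ b) (hV : IsAdjointFundamental a b A V) :
    V a = 1 := by
  ext i j
  simpa using (hV i j).2 a (left_mem_Icc.2 hab)

theorem IsAdjointFundamental.isPrimitiveOn (hab : a ≤ b) (hV : IsAdjointFundamental a b A V)
    (i j) : IsPrimitiveOn a b (fun s => V s i j) (fun s => (-(V s * A s)) i j) :=
  IsPrimitiveOn.of_eq ((1 : Matrix (Fin p ⊕ Fin q) (Fin p ⊕ Fin q) ℝ) i j) hab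
    (hV i j).1.neg
    (by simpa [sub_eq_add_neg] using (hV i j).2)

theorem exists_isFundamental (hab : a ≤ b)
    (hA : ∀ i j, IntervalIntegrable (fun t => A t i j) volume a b) :
    ∃ U, IsFundamental a b A U := by
  choose z hz0 hz using fun j =>
    exists_isPrimitiveOn_mulVec hab hA fun i =>
      (1 : Matrix (Fin p ⊕ Fin q) (Fin p ⊕ Fin q) ℝ) i j
  refine ⟨fun s => Matrix.of fun i j => z j s i, fun i j => ⟨(hz j i).1, fun s hs => ?_⟩⟩
  have h : z j s i = z j a i + ∫ t in a..s, (A t).mulVec (z j t) i := (hz j i).2 s hs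
  rw [hz0 j] at h
  exact h

/-- Transposition reduces to the previous case: if W' = -Aᵀ W, then V = Wᵀ satisfies V' = -V A. -/
theorem exists_isAdjointFundamental (hab : a ≤ b)
    (hA : ∀ i j, IntervalIntegrable (fun t => A t i j) volume a b) :
    ∃ V, IsAdjointFundamental a b A V := by
  obtain ⟨W, hW⟩ := exists_isFundamental (A := fun t => -(A t).transpose) hab
    (fun i j => (hA j i).neg)
  have key : ∀ t i j, ((-(A t).transpose) * W t) j i = -((W t).transpose * A t) i j := by
    intro t i j
    simp [Matrix.mul_apply, mul_comm]
  refine ⟨fun t => (W t).transpose, fun i j => ⟨?_, fun s hs => ?_⟩⟩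
  · have h := (hW j i).1
    simp only [key] at h
    exact h.neg.congr fun t _ => by simp
  · have h := (hW j i).2 s hs
    simp only [key, intervalIntegral.integral_neg] at h
    simp only [Matrix.transpose_apply, h, sub_eq_add_neg, Matrix.one_apply, eq_comm]

/-- The derivative of V U is -V A U + V A U = 0, and V U = I at a. -/
theorem adjoint_mul_fundamental (hab : a ≤ b) (hU : IsFundamental a b A U)
    (hV : IsAdjointFundamental a b A V) {s : ℝ} (hs : s ∈ Icc a b) : V s * U s = 1 := by
  ext i j
  have h := (isPrimitiveOn_matrix_mul hab (hV.isPrimitiveOn hab) (hU.isPrimitiveOn hab) i j).2 s hs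
  simpa [hU.left_eq_one hab, hV.left_eq_one hab, Matrix.mul_assoc] using h

theorem fundamental_mul_adjoint (hab : a ≤ b) (hU : IsFundamental a b A U)
    (hV : IsAdjointFundamental a b A V) {s : ℝ} (hs : s ∈ Icc a b) : U s * V s = 1 :=
  mul_eq_one_comm.1 (adjoint_mul_fundamental hab hU hV hs)

/-- Both U and U' are pointwise inverses of the same V. -/
theorem IsFundamental.eqOn (hab : a ≤ b) {U' : ℝ → Matrix (Fin p ⊕ Fin q) (Fin p ⊕ Fin q) ℝ}
    (hU : IsFundamental a b A U) (hU' : IsFundamental a b A U')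
    (hV : IsAdjointFundamental a b A V) : EqOn U' U (Icc a b) := fun _ hs =>
  (left_inv_eq_right_inv (fundamental_mul_adjoint hab hU hV hs)
    (adjoint_mul_fundamental hab hU' hV hs)).symm

theorem IsAdjointFundamental.eqOn (hab : a ≤ b)
    {V' : ℝ → Matrix (Fin p ⊕ Fin q) (Fin p ⊕ Fin q) ℝ} (hV : IsAdjointFundamental a b A V)
    (hV' : IsAdjointFundamental a b A V') (hU : IsFundamental a b A U) :
    EqOn V' V (Icc a b) := fun _ hs =>
  left_inv_eq_right_inv (adjoint_mul_fundamental hab hU hV' hs)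
    (fundamental_mul_adjoint hab hU hV hs)

/-- Variation of constants: a solution of `z' = A z + g` is given by the Duhamel formula. -/
theorem eq_fundamental_mulVec (hab : a ≤ b) (hU : IsFundamental a b A U)
    (hV : IsAdjointFundamental a b A V) {z g : ℝ → Fin p ⊕ Fin q → ℝ}
    (hz : ∀ i, IsPrimitiveOn a b (fun s => z s i) (fun s => ((A s).mulVec (z s) + g s) i))
    {s : ℝ} (hs : s ∈ Icc a b) :
    z s = (U s).mulVec (z a + fun i => ∫ t in a..s, (V t).mulVec (g t) i) := by
  -- V is an integrating factor: (V z)' = -V A z + V (A z + g) = V g.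
  have h : (V s).mulVec (z s) = z a + fun i => ∫ t in a..s, (V t).mulVec (g t) i := by
    funext i
    have h := (isPrimitiveOn_mulVec hab (hV.isPrimitiveOn hab) hz i).2 s hs
    simpa [hV.left_eq_one hab, Matrix.neg_mulVec, Matrix.mulVec_add, Matrix.mulVec_mulVec] using h
  rw [← h, Matrix.mulVec_mulVec, fundamental_mul_adjoint hab hU hV hs, Matrix.one_mulVec]

/-- Variation of constants: the Duhamel formula solves `z' = A z + g`. -/
theorem isPrimitiveOn_fundamental_mulVec (hab : a ≤ b) (hU : IsFundamental a b A U)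
    (hV : IsAdjointFundamental a b A V) {g : ℝ → Fin p ⊕ Fin q → ℝ}
    (hg : ∀ i, IntervalIntegrable (fun t => (V t).mulVec (g t) i) volume a b)
    (c : Fin p ⊕ Fin q → ℝ) (i : Fin p ⊕ Fin q) :
    IsPrimitiveOn a b
      (fun s => (U s).mulVec (c + fun i => ∫ t in a..s, (V t).mulVec (g t) i) i)
      (fun s => ((A s).mulVec ((U s).mulVec (c + fun i => ∫ t in a..s, (V t).mulVec (g t) i))
        + g s) i) := by
  have hw : ∀ i, IsPrimitiveOn a b (fun s => (c + fun i => ∫ t in a..s, (V t).mulVec (g t) i) i)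
      (fun s => (V s).mulVec (g s) i) := fun i => by
    simpa using (IsPrimitiveOn.const (c i)).add (IsPrimitiveOn.integral (hg i))
  -- The product rule gives A U w + U V g; here U V = I is known only on [a,b].
  refine (isPrimitiveOn_mulVec hab (hU.isPrimitiveOn hab) hw i).congr_ae hab ?_
  refine (ae_restrict_iff' measurableSet_Icc).2 (Filter.Eventually.of_forall fun t ht => ?_)
  simp only [Matrix.mulVec_mulVec, Pi.add_apply]
  rw [fundamental_mul_adjoint hab hU hV ht, Matrix.one_mulVec]

theorem IsFundamental.continuousOn (hab : a ≤ b) (hU : IsFundamental a b A U) (i j) :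
    ContinuousOn (fun s => U s i j) (Icc a b) :=
  (hU.isPrimitiveOn hab i j).continuousOn

theorem IsAdjointFundamental.continuousOn (hab : a ≤ b) (hV : IsAdjointFundamental a b A V)
    (i j) : ContinuousOn (fun s => V s i j) (Icc a b) :=
  (hV.isPrimitiveOn hab i j).continuousOn

end Fundamental

/-! ### The boundary condition at b. -/

section Blocks

variable {p q : ℕ}

/-- If `c = (0, c₂)`, the second block of `U_b (c + w)` vanishes exactly when `c = -P w`. -/
theorem mulVec_add_inr_eq_zero_iff {Ub : Matrix (Fin p ⊕ Fin q) (Fin p ⊕ Fin q) ℝ}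
    (hUb : IsUnit Ub.toBlocks₂₂) {c : Fin p ⊕ Fin q → ℝ} (hc : ∀ i, c (Sum.inl i) = 0)
    (w : Fin p ⊕ Fin q → ℝ) :
    (∀ j, Ub.mulVec (c + w) (Sum.inr j) = 0) ↔ c = -(projP Ub).mulVec w := by
  have hdet := (Matrix.isUnit_iff_isUnit_det _).1 hUb
  set w₁ : Fin p → ℝ := w ∘ Sum.inl
  set w₂ : Fin q → ℝ := w ∘ Sum.inr
  set c₂ : Fin q → ℝ := c ∘ Sum.inr
  have hw : w = Sum.elim w₁ w₂ := (Sum.elim_comp_inl_inr w).symm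
  have hc' : c = Sum.elim (0 : Fin p → ℝ) c₂ := by
    rw [← Sum.elim_comp_inl_inr c]; congr 1; funext i; exact hc i
  have h1 : (fun j => Ub.mulVec (c + w) (Sum.inr j)) =
      Ub.toBlocks₂₁.mulVec w₁ + Ub.toBlocks₂₂.mulVec (c₂ + w₂) := by
    have : c + w = Sum.elim w₁ (c₂ + w₂) := by
      rw [hc', hw]; funext i; cases i <;> simp
    funext j
    conv_lhs => rw [this, ← Matrix.fromBlocks_toBlocks Ub, Matrix.fromBlocks_mulVec]
    simp
  have h2 : -(projP Ub).mulVec w =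
      Sum.elim (0 : Fin p → ℝ) (-((Ub.toBlocks₂₂⁻¹ * Ub.toBlocks₂₁).mulVec w₁ + w₂)) := by
    rw [hw, projP, Matrix.fromBlocks_mulVec]
    funext i; cases i <;> simp
  have h3 : (∀ j, Ub.mulVec (c + w) (Sum.inr j) = 0) ↔
      Ub.toBlocks₂₁.mulVec w₁ + Ub.toBlocks₂₂.mulVec (c₂ + w₂) = 0 := by
    rw [← h1, funext_iff]; rfl
  rw [h3, h2, hc']
  constructor
  · intro h
    have h := congrArg (Ub.toBlocks₂₂⁻¹).mulVec h
    rw [Matrix.mulVec_add, Matrix.mulVec_mulVec, Matrix.mulVec_mulVec,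
      Matrix.nonsing_inv_mul _ hdet, Matrix.one_mulVec, Matrix.mulVec_zero] at h
    congr 1
    rw [eq_neg_iff_add_eq_zero, ← h]
    abel
  · intro h
    have h' : c₂ = -((Ub.toBlocks₂₂⁻¹ * Ub.toBlocks₂₁).mulVec w₁ + w₂) := by
      funext j
      simpa using congrFun h (Sum.inr j)
    have h'' : c₂ + w₂ = -(Ub.toBlocks₂₂⁻¹ * Ub.toBlocks₂₁).mulVec w₁ := by
      rw [h']; abel
    rw [h'', Matrix.mulVec_neg, Matrix.mulVec_mulVec, ← Matrix.mul_assoc,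
      Matrix.mul_nonsing_inv _ hdet, Matrix.one_mul, add_neg_cancel]

end Blocks

end ThreePI

namespace ThreePI

/-! ### Integrability of matrix products. -/

section Entries

variable {l m k : Type} [Fintype m] {a b : ℝ} {r₁ r₂ r : ENNReal}

theorem EntriesMemLp.mul [ENNReal.HolderTriple r₁ r₂ r] {M : ℝ → Matrix l m ℝ}
    {N : ℝ → Matrix m k ℝ} (hM : EntriesMemLp r₁ a b M) (hN : EntriesMemLp r₂ a b N) :
    EntriesMemLp r a b (fun s => M s * N s) := by
  intro i j
  simp only [Matrix.mul_apply]
  exact memLp_finsetSum _ fun c _ => (hN c j).mul' (hM i c)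

theorem EntriesMemLp.mulVec [ENNReal.HolderTriple r₁ r₂ r] {M : ℝ → Matrix l m ℝ}
    {x : ℝ → m → ℝ} (hM : EntriesMemLp r₁ a b M)
    (hx : ∀ j, MemLp (fun s => x s j) r₂ (volume.restrict (Icc a b))) (i : l) :
    MemLp (fun s => (M s).mulVec (x s) i) r (volume.restrict (Icc a b)) := by
  simp only [Matrix.mulVec, dotProduct]
  exact memLp_finsetSum _ fun c _ => (hx c).mul' (hM i c)

theorem EntriesMemLp.neg {M : ℝ → Matrix l k ℝ} (hM : EntriesMemLp r a b M) :
    EntriesMemLp r a b (fun s => -M s) := fun i j => (hM i j).neg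

theorem EntriesMemLp.const (M : Matrix l k ℝ) : EntriesMemLp r a b (fun _ => M) :=
  fun i j => memLp_const (M i j)

theorem memLp_top_of_continuousOn {f : ℝ → ℝ} (hf : ContinuousOn f (Icc a b)) :
    MemLp f ⊤ (volume.restrict (Icc a b)) := by
  obtain ⟨C, hC⟩ := isCompact_Icc.exists_bound_of_continuousOn hf
  exact memLp_top_of_bound (hf.aestronglyMeasurable measurableSet_Icc) C
    ((ae_restrict_iff' measurableSet_Icc).2 (Filter.Eventually.of_forall hC))

theorem intervalIntegrable_of_memLp_one (hab : a ≤ b) {f : ℝ → ℝ}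
    (hf : MemLp f 1 (volume.restrict (Icc a b))) : IntervalIntegrable f volume a b :=
  (intervalIntegrable_iff_integrableOn_Icc_of_le hab).2 (memLp_one_iff_integrable.1 hf)

theorem EntriesMemLp.intervalIntegrable_mulVec (hab : a ≤ b) {M : ℝ → Matrix l m ℝ}
    {x : ℝ → m → ℝ} (hM : EntriesMemLp 2 a b M)
    (hx : ∀ j, MemLp (fun s => x s j) 2 (volume.restrict (Icc a b))) (i : l) :
    IntervalIntegrable (fun s => (M s).mulVec (x s) i) volume a b :=
  intervalIntegrable_of_memLp_one hab (hM.mulVec hx i)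

variable {n p q : ℕ} {F₁ : ℝ → Matrix (Fin n) (Fin p) ℝ} {G₁ : ℝ → Matrix (Fin p) (Fin n) ℝ}
  {F₂ : ℝ → Matrix (Fin n) (Fin q) ℝ} {G₂ : ℝ → Matrix (Fin q) (Fin n) ℝ}

theorem EntriesMemLp.rowF (hF₁ : EntriesMemLp r a b F₁) (hF₂ : EntriesMemLp r a b F₂) :
    EntriesMemLp r a b (rowF F₁ F₂) := by
  rintro i (j | j)
  · exact hF₁ i j
  · exact hF₂ i j

theorem EntriesMemLp.colG (hG₁ : EntriesMemLp r a b G₁) (hG₂ : EntriesMemLp r a b G₂) :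
    EntriesMemLp r a b (colG G₁ G₂) := by
  rintro (i | i) j
  · exact hG₁ i j
  · exact (hG₂ i j).neg

theorem coeff_eq_mul (t : ℝ) : coeff F₁ G₁ F₂ G₂ t = colG G₁ G₂ t * rowF F₁ F₂ t := by
  rw [coeff, colG, rowF, Matrix.fromRows_mul_fromCols]
  simp

theorem intervalIntegrable_coeff (hab : a ≤ b) (hF₁ : EntriesMemLp 2 a b F₁)
    (hG₁ : EntriesMemLp 2 a b G₁) (hF₂ : EntriesMemLp 2 a b F₂) (hG₂ : EntriesMemLp 2 a b G₂)
    (i j) : IntervalIntegrable (fun t => coeff F₁ G₁ F₂ G₂ t i j) volume a b := by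
  simp only [coeff_eq_mul]
  exact intervalIntegrable_of_memLp_one hab ((hG₁.colG hG₂).mul (hF₁.rowF hF₂) i j)

end Entries

/-! ### The state and its two-point boundary value problem. -/

section State

variable {n p q : ℕ} {a b : ℝ} {F₁ : ℝ → Matrix (Fin n) (Fin p) ℝ}
  {G₁ : ℝ → Matrix (Fin p) (Fin n) ℝ} {F₂ : ℝ → Matrix (Fin n) (Fin q) ℝ}
  {G₂ : ℝ → Matrix (Fin q) (Fin n) ℝ} {x y : ℝ → Fin n → ℝ}

/-- The state `(∫_a^s G₁ x, ∫_s^b G₂ x)` attached to the input `x`. -/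
noncomputable def state (a b : ℝ) (G₁ : ℝ → Matrix (Fin p) (Fin n) ℝ)
    (G₂ : ℝ → Matrix (Fin q) (Fin n) ℝ) (x : ℝ → Fin n → ℝ) (s : ℝ) : Fin p ⊕ Fin q → ℝ :=
  Sum.elim (fun i => ∫ t in a..s, (G₁ t).mulVec (x t) i)
    (fun j => ∫ t in s..b, (G₂ t).mulVec (x t) j)

theorem colG_mulVec_inl (t : ℝ) (v : Fin n → ℝ) (i : Fin p) :
    (colG G₁ G₂ t).mulVec v (Sum.inl i) = (G₁ t).mulVec v i := by
  simp [colG]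

theorem colG_mulVec_inr (t : ℝ) (v : Fin n → ℝ) (j : Fin q) :
    (colG G₁ G₂ t).mulVec v (Sum.inr j) = -(G₂ t).mulVec v j := by
  simp [colG, Matrix.neg_mulVec]

theorem integral_right_eq {f : ℝ → ℝ} (hf : IntervalIntegrable f volume a b)
    {s : ℝ} (hs : s ∈ Icc a b) :
    ∫ t in s..b, f t = (∫ t in a..b, f t) - ∫ t in a..s, f t := by
  rw [intervalIntegral.integral_interval_sub_left hf
    ((IsPrimitiveOn.integral hf).intervalIntegrable_of_mem hs)]

theorem isPrimitiveOn_state (hab : a ≤ b) (hG₁ : EntriesMemLp 2 a b G₁)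
    (hG₂ : EntriesMemLp 2 a b G₂)
    (hx : ∀ k, MemLp (fun s => x s k) 2 (volume.restrict (Icc a b))) (i : Fin p ⊕ Fin q) :
    IsPrimitiveOn a b (fun s => state a b G₁ G₂ x s i)
      (fun s => (colG G₁ G₂ s).mulVec (x s) i) := by
  rcases i with i | j
  · simp only [colG_mulVec_inl]
    exact IsPrimitiveOn.integral (hG₁.intervalIntegrable_mulVec hab hx i)
  · simp only [colG_mulVec_inr]
    have h := hG₂.intervalIntegrable_mulVec hab hx j
    refine IsPrimitiveOn.of_eq (∫ t in a..b, (G₂ t).mulVec (x t) j) hab h.neg fun s hs => ?_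
    rw [intervalIntegral.integral_neg, ← sub_eq_add_neg, ← integral_right_eq h hs]
    rfl

/-- A primitive is fixed by its value at one point; for the first block that point is a, for the
second it is b. -/
theorem eq_state_of_isPrimitiveOn (hab : a ≤ b) (hG₁ : EntriesMemLp 2 a b G₁)
    (hG₂ : EntriesMemLp 2 a b G₂)
    (hx : ∀ k, MemLp (fun s => x s k) 2 (volume.restrict (Icc a b)))
    {z : ℝ → Fin p ⊕ Fin q → ℝ}
    (hz : ∀ i, IsPrimitiveOn a b (fun s => z s i) (fun s => (colG G₁ G₂ s).mulVec (x s) i))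
    (hza : ∀ i, z a (Sum.inl i) = 0) (hzb : ∀ j, z b (Sum.inr j) = 0) {s : ℝ}
    (hs : s ∈ Icc a b) : z s = state a b G₁ G₂ x s := by
  have hx' := isPrimitiveOn_state hab hG₁ hG₂ hx
  funext i
  have h1 := (hz i).2
  have h2 := (hx' i).2
  rcases i with i | j
  · have e1 := h1 s hs
    have e2 := h2 s hs
    have e3 : state a b G₁ G₂ x a (Sum.inl i) = 0 := by simp [state]
    simp only [hza, e3] at e1 e2
    rw [e1, e2]
  · have e1 := h1 s hs
    have e2 := h2 s hs
    have e1' := h1 b (right_mem_Icc.2 hab)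
    have e2' := h2 b (right_mem_Icc.2 hab)
    have e3 : state a b G₁ G₂ x b (Sum.inr j) = 0 := by simp [state]
    simp only [hzb, e3] at e1' e2'
    linarith

variable {U V : ℝ → Matrix (Fin p ⊕ Fin q) (Fin p ⊕ Fin q) ℝ}

theorem IsAdjointFundamental.entriesMemLp_mul_colG (hab : a ≤ b) (hG₁ : EntriesMemLp 2 a b G₁)
    (hG₂ : EntriesMemLp 2 a b G₂) {A : ℝ → Matrix (Fin p ⊕ Fin q) (Fin p ⊕ Fin q) ℝ}
    (hV : IsAdjointFundamental a b A V) :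
    EntriesMemLp 2 a b (fun t => V t * ThreePI.colG G₁ G₂ t) :=
  EntriesMemLp.mul (r₁ := ⊤) (fun i j => memLp_top_of_continuousOn (hV.continuousOn hab i j))
    (hG₁.colG hG₂)

theorem IsFundamental.entriesMemLp_rowF_mul (hab : a ≤ b) (hF₁ : EntriesMemLp 2 a b F₁)
    (hF₂ : EntriesMemLp 2 a b F₂) {A : ℝ → Matrix (Fin p ⊕ Fin q) (Fin p ⊕ Fin q) ℝ}
    (hU : IsFundamental a b A U) :
    EntriesMemLp 2 a b (fun t => ThreePI.rowF F₁ F₂ t * U t) :=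
  EntriesMemLp.mul (r₂ := ⊤) (hF₁.rowF hF₂)
    (fun i j => memLp_top_of_continuousOn (hU.continuousOn hab i j))

/-- The equation `y = x - F · state x` is solved for `x` by the Duhamel formula with the initial
value `-P w`, where `w = ∫_a^b V B y`. -/
theorem eq_sub_state_iff (hab : a ≤ b) (hG₁ : EntriesMemLp 2 a b G₁)
    (hG₂ : EntriesMemLp 2 a b G₂)
    (hU : IsFundamental a b (coeff F₁ G₁ F₂ G₂) U)
    (hV : IsAdjointFundamental a b (coeff F₁ G₁ F₂ G₂) V)
    (hUb : IsUnit (U b).toBlocks₂₂)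
    (hx : ∀ k, MemLp (fun s => x s k) 2 (volume.restrict (Icc a b)))
    (hy : ∀ k, MemLp (fun s => y s k) 2 (volume.restrict (Icc a b))) :
    (∀ᵐ s ∂(volume.restrict (Icc a b)),
      y s = x s - (rowF F₁ F₂ s).mulVec (state a b G₁ G₂ x s)) ↔
    (∀ᵐ s ∂(volume.restrict (Icc a b)), x s = y s + (rowF F₁ F₂ s).mulVec ((U s).mulVec
      (-(projP (U b)).mulVec (fun i => ∫ t in a..b, (V t).mulVec ((colG G₁ G₂ t).mulVec (y t)) i)
        + fun i => ∫ t in a..s, (V t).mulVec ((colG G₁ G₂ t).mulVec (y t)) i))) := by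
  have hbm := right_mem_Icc.2 hab
  constructor
  · intro h
    have hz : ∀ i, IsPrimitiveOn a b (fun s => state a b G₁ G₂ x s i) (fun s =>
        ((coeff F₁ G₁ F₂ G₂ s).mulVec (state a b G₁ G₂ x s) + (colG G₁ G₂ s).mulVec (y s)) i) := by
      intro i
      -- Substituting x = y + F z into z' = B x gives z' = A z + B y.
      refine (isPrimitiveOn_state hab hG₁ hG₂ hx i).congr_ae hab ?_
      filter_upwards [h] with s hs
      rw [hs, Matrix.mulVec_sub, Matrix.mulVec_mulVec, coeff_eq_mul, add_sub_cancel]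
    have hform : ∀ s ∈ Icc a b, _ := fun s hs => eq_fundamental_mulVec hab hU hV hz hs
    have hc : state a b G₁ G₂ x a = -(projP (U b)).mulVec
        (fun i => ∫ t in a..b, (V t).mulVec ((colG G₁ G₂ t).mulVec (y t)) i) := by
      refine (mulVec_add_inr_eq_zero_iff hUb (fun i => by simp [state]) _).1 fun j => ?_
      rw [← hform b hbm]
      simp [state]
    filter_upwards [h, ae_restrict_mem measurableSet_Icc] with s hs hsm
    rw [← hc, ← hform s hsm, hs, sub_add_cancel]
  · intro h
    have hg : ∀ i, IntervalIntegrable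
        (fun t => (V t).mulVec ((colG G₁ G₂ t).mulVec (y t)) i) volume a b := fun i => by
      simpa only [Matrix.mulVec_mulVec] using
        (hV.entriesMemLp_mul_colG hab hG₁ hG₂).intervalIntegrable_mulVec hab hy i
    set c := -(projP (U b)).mulVec
      (fun i => ∫ t in a..b, (V t).mulVec ((colG G₁ G₂ t).mulVec (y t)) i) with hc
    have hc0 : ∀ i, c (Sum.inl i) = 0 := fun i => by
      rw [hc, projP, Pi.neg_apply, Matrix.fromBlocks_mulVec]; simp
    have hz := fun i => (isPrimitiveOn_fundamental_mulVec hab hU hV hg c i).congr_ae hab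
      (g' := fun s => (colG G₁ G₂ s).mulVec (x s) i) (by
        filter_upwards [h] with s hs
        rw [hs, Matrix.mulVec_add (colG G₁ G₂ s), Matrix.mulVec_mulVec _ (colG G₁ G₂ s), coeff_eq_mul, add_comm])
    -- The Duhamel expression has derivative B x and, by the choice of c, both boundary values of
    -- the state; hence it is the state of x.
    have hst := fun s (hs : s ∈ Icc a b) => eq_state_of_isPrimitiveOn hab hG₁ hG₂ hx
      (z := fun s => (U s).mulVec (c + fun i =>
        ∫ t in a..s, (V t).mulVec ((colG G₁ G₂ t).mulVec (y t)) i)) hz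
      (fun i => by
        simp only [hU.left_eq_one hab, Matrix.one_mulVec, intervalIntegral.integral_same,
          Pi.add_apply, hc0, add_zero])
      ((mulVec_add_inr_eq_zero_iff hUb hc0 _).2 hc) hs
    filter_upwards [h, ae_restrict_mem measurableSet_Icc] with s hs hsm
    rw [← hst s hsm]
    rw [eq_sub_iff_add_eq, ← hs]

/-- If `U₂₂(b)` is singular, the equation `x = F · state x` has a nontrivial solution. -/
theorem exists_eq_state_of_not_isUnit (hab : a ≤ b) (hF₁ : EntriesMemLp 2 a b F₁)
    (hG₁ : EntriesMemLp 2 a b G₁) (hF₂ : EntriesMemLp 2 a b F₂) (hG₂ : EntriesMemLp 2 a b G₂)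
    (hU : IsFundamental a b (coeff F₁ G₁ F₂ G₂) U) (hUb : ¬ IsUnit (U b).toBlocks₂₂) :
    ∃ x : ℝ → Fin n → ℝ, (∀ k, MemLp (fun s => x s k) 2 (volume.restrict (Icc a b))) ∧
      (∀ s ∈ Icc a b, x s = (rowF F₁ F₂ s).mulVec (state a b G₁ G₂ x s)) ∧
      ¬ ∀ᵐ s ∂(volume.restrict (Icc a b)), x s = 0 := by
  have hdet : (U b).toBlocks₂₂.det = 0 := by
    by_contra h
    exact hUb ((Matrix.isUnit_iff_isUnit_det _).2 (isUnit_iff_ne_zero.2 h))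
  obtain ⟨c₂, hc₂, hker⟩ := Matrix.exists_mulVec_eq_zero_iff.2 hdet
  set c : Fin p ⊕ Fin q → ℝ := Sum.elim 0 c₂ with hc
  set x : ℝ → Fin n → ℝ := fun s => (rowF F₁ F₂ s).mulVec ((U s).mulVec c) with hxdef
  have hx : ∀ k, MemLp (fun s => x s k) 2 (volume.restrict (Icc a b)) := fun k => by
    simp only [hxdef, Matrix.mulVec_mulVec]
    exact (hU.entriesMemLp_rowF_mul hab hF₁ hF₂).mulVec (r₂ := ⊤) (r := 2) (x := fun _ => c)
      (fun j => memLp_const (c j)) k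
  have hz : ∀ i, IsPrimitiveOn a b (fun s => (U s).mulVec c i)
      (fun s => (colG G₁ G₂ s).mulVec (x s) i) := fun i => by
    have h := isPrimitiveOn_mulVec hab (hU.isPrimitiveOn hab)
      (fun j => IsPrimitiveOn.const (c j)) i
    refine h.congr_ae hab (Filter.Eventually.of_forall fun s => ?_)
    have h0 : (U s).mulVec (fun _ => (0 : ℝ)) = 0 := Matrix.mulVec_zero _
    simp only [h0, add_zero, hxdef, Matrix.mulVec_mulVec, coeff_eq_mul, Matrix.mul_assoc]
  have hUb0 : ∀ j, (U b).mulVec c (Sum.inr j) = 0 := fun j => by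
    rw [← Matrix.fromBlocks_toBlocks (U b), hc, Matrix.fromBlocks_mulVec]
    simp [hker]
  have hst := fun s (hs : s ∈ Icc a b) => eq_state_of_isPrimitiveOn hab hG₁ hG₂ hx
    (z := fun s => (U s).mulVec c) hz (fun i => by simp [hU.left_eq_one hab, hc]) hUb0 hs
  refine ⟨x, hx, fun s hs => by rw [← hst s hs], fun h0 => hc₂ ?_⟩
  funext j
  -- If x = 0 a.e., then z' = B x makes z constant; its second block is c₂ at a and 0 at b.
  have h1 := ((hz (Sum.inr j)).congr_ae hab (g' := fun _ => 0) (by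
    filter_upwards [h0] with s hs
    rw [hs, Matrix.mulVec_zero]; rfl)).2 b (right_mem_Icc.2 hab)
  simp only [hUb0, hU.left_eq_one hab, Matrix.one_mulVec, intervalIntegral.integral_zero,
    add_zero] at h1
  exact h1.symm

end State

end ThreePI

namespace ThreePI

/-! ### Bounded operators on L² from pointwise formulas. -/

section LpOperators

/-- A pointwise-defined, additive and homogeneous map with an `Lᵖ` bound induces a bounded operator
on `Lᵖ`. -/
theorem exists_continuousLinearMap_of_bound {X E F : Type*} [MeasurableSpace X] {μ : Measure X}
    [NormedAddCommGroup E] [NormedSpace ℝ E] [NormedAddCommGroup F] [NormedSpace ℝ F]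
    {r : ENNReal} [Fact (1 ≤ r)] (Φ : Lp E r μ → X → F)
    (hmeas : ∀ x, AEStronglyMeasurable (Φ x) μ)
    (hadd : ∀ x y, Φ (x + y) =ᵐ[μ] Φ x + Φ y) (hsmul : ∀ (c : ℝ) x, Φ (c • x) =ᵐ[μ] c • Φ x)
    {C : ENNReal} (hC : C ≠ ⊤) (hbound : ∀ x, eLpNorm (Φ x) r μ ≤ C * eLpNorm x r μ) :
    ∃ T : Lp E r μ →L[ℝ] Lp F r μ, ∀ x, T x =ᵐ[μ] Φ x := by
  have hmem : ∀ x, MemLp (Φ x) r μ := fun x =>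
    ⟨hmeas x, (hbound x).trans_lt (ENNReal.mul_lt_top hC.lt_top (Lp.memLp x).2)⟩
  refine ⟨LinearMap.mkContinuous
    { toFun := fun x => (hmem x).toLp (Φ x)
      map_add' := fun x y => ?_
      map_smul' := fun c x => ?_ } C.toReal fun x => ?_, fun x => (hmem x).coeFn_toLp⟩
  · rw [← MemLp.toLp_add]
    exact MemLp.toLp_congr _ _ (hadd x y)
  · rw [RingHom.id_apply, ← MemLp.toLp_const_smul]
    exact MemLp.toLp_congr _ _ (hsmul c x)
  · rw [LinearMap.coe_mk, AddHom.coe_mk, Lp.norm_toLp, Lp.norm_def, ← ENNReal.toReal_mul]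
    exact ENNReal.toReal_mono (ENNReal.mul_ne_top hC (Lp.memLp x).2.ne) (hbound x)

end LpOperators

section Norms

variable {n : ℕ} {m : Type*} [Fintype m]

theorem norm_toLp_mulVec_le (M : Matrix (Fin n) m ℝ) (v : m → ℝ) :
    ‖WithLp.toLp 2 (M.mulVec v)‖ ≤ absSum M * ‖v‖ := by
  calc ‖WithLp.toLp 2 (M.mulVec v)‖ ≤ ∑ i, |M.mulVec v i| := by
        rw [EuclideanSpace.norm_eq]
        refine Real.sqrt_le_iff.2 ⟨Finset.sum_nonneg fun _ _ => abs_nonneg _, ?_⟩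
        exact Finset.sum_sq_le_sq_sum_of_nonneg fun _ _ => abs_nonneg _
    _ ≤ ∑ i, (∑ j, |M i j|) * ‖v‖ := by
        refine Finset.sum_le_sum fun i _ => ?_
        rw [Finset.sum_mul]
        refine (Finset.abs_sum_le_sum_abs _ _).trans (Finset.sum_le_sum fun j _ => ?_)
        rw [abs_mul]
        exact mul_le_mul_of_nonneg_left (norm_le_pi_norm v j) (abs_nonneg _)
    _ = _ := by rw [absSum, Finset.sum_mul]

theorem norm_ofLp_le (v : EuclideanSpace ℝ m) : ‖v.ofLp‖ ≤ ‖v‖ :=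
  (pi_norm_le_iff_of_nonneg (norm_nonneg _)).2 fun i => PiLp.norm_apply_le v i

end Norms

/-! ### Operators with separable kernels. -/

section SeparableKernels

variable {n : ℕ} {m m₁ m₂ : Type} [Fintype m] [Fintype m₁] [Fintype m₂] {a b : ℝ}

theorem EntriesMemLp.sum_abs {l : Type} [Fintype l] {r : ENNReal} {M : ℝ → Matrix l m ℝ}
    (hM : EntriesMemLp r a b M) :
    MemLp (fun s => absSum (M s)) r (volume.restrict (Icc a b)) :=
  memLp_finsetSum _ fun i _ => memLp_finsetSum _ fun j _ => (hM i j).abs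

theorem memLp_coord (x : L2 n a b) (k : Fin n) :
    MemLp (fun s => (x s).ofLp k) 2 (volume.restrict (Icc a b)) :=
  (Lp.memLp x).eval_piLp k

theorem eLpNorm_le_eLpNorm_absSum_mul {l k : Type} [Fintype l] [Fintype k] {E : Type*}
    [NormedAddCommGroup E] {r₁ r₂ r : ENNReal} [ENNReal.HolderTriple r₁ r₂ r]
    {M : ℝ → Matrix l k ℝ} (hM : EntriesMemLp r₁ a b M) {F : Type*} [NormedAddCommGroup F]
    {f : ℝ → F} {x : ℝ → E} (hx : AEStronglyMeasurable x (volume.restrict (Icc a b)))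
    (h : ∀ s, ‖f s‖ ≤ absSum (M s) * ‖x s‖) :
    eLpNorm f r (volume.restrict (Icc a b)) ≤
      eLpNorm (fun s => absSum (M s)) r₁ (volume.restrict (Icc a b)) *
        eLpNorm x r₂ (volume.restrict (Icc a b)) := by
  rw [← eLpNorm_norm x]
  refine (eLpNorm_mono_real h).trans ?_
  exact eLpNorm_smul_le_mul_eLpNorm (𝕜 := ℝ) (E := ℝ) hx.norm hM.sum_abs.1

theorem exists_multiplication {R : ℝ → Matrix (Fin n) (Fin n) ℝ} (hR : EntriesMemLp ⊤ a b R) :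
    ∃ T : L2 n a b →L[ℝ] L2 n a b, ∀ x, ∀ᵐ s ∂(volume.restrict (Icc a b)),
      (T x) s = act (R s) (x s) := by
  refine exists_continuousLinearMap_of_bound (fun x s => act (R s) (x s)) (fun x => ?_)
    (fun x y => ?_) (fun c x => ?_) hR.sum_abs.2.ne (fun x => ?_)
  · exact (memLp_piLp_iff.2 fun i => hR.mulVec (r₂ := 2) (r := 2) (memLp_coord x) i).1
  · filter_upwards [Lp.coeFn_add x y] with s hs
    rw [hs, Pi.add_apply, Pi.add_apply]
    simp [act, Matrix.mulVec_add]
  · filter_upwards [Lp.coeFn_smul c x] with s hs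
    rw [hs, Pi.smul_apply, Pi.smul_apply]
    simp [act, Matrix.mulVec_smul]
  · exact eLpNorm_le_eLpNorm_absSum_mul hR (Lp.aestronglyMeasurable x) fun s =>
      (norm_toLp_mulVec_le _ _).trans
        (mul_le_mul_of_nonneg_left (norm_ofLp_le _) (absSum_nonneg _))

/-- Enlarging the domain to [a,b] before using Hölder's inequality makes the bound uniform in c. -/
theorem norm_integral_mulVec_le {G : ℝ → Matrix m (Fin n) ℝ} (hG : EntriesMemLp 2 a b G)
    (x : L2 n a b) {c : ℝ} (hc : c ∈ Icc a b) :
    ‖fun j => ∫ t in a..c, (G t).mulVec (x t).ofLp j‖ ≤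
      (eLpNorm (fun s => absSum (G s)) 2 (volume.restrict (Icc a b)) *
        eLpNorm x 2 (volume.restrict (Icc a b))).toReal := by
  have hD := ENNReal.mul_ne_top hG.sum_abs.2.ne (Lp.memLp x).2.ne
  refine (pi_norm_le_iff_of_nonneg ENNReal.toReal_nonneg).2 fun j => ?_
  rw [← ENNReal.ofReal_le_iff_le_toReal hD, ofReal_norm, intervalIntegral.integral_of_le hc.1]
  calc ‖∫ t in Ioc a c, (G t).mulVec (x t).ofLp j‖ₑ
      ≤ ∫⁻ t in Ioc a c, ‖(G t).mulVec (x t).ofLp j‖ₑ := enorm_integral_le_lintegral_enorm _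
    _ ≤ ∫⁻ t in Icc a b, ‖(G t).mulVec (x t).ofLp j‖ₑ :=
        lintegral_mono_set fun t ht => ⟨ht.1.le, ht.2.trans hc.2⟩
    _ = eLpNorm (fun t => (G t).mulVec (x t).ofLp j) 1 (volume.restrict (Icc a b)) :=
        eLpNorm_one_eq_lintegral_enorm.symm
    _ ≤ _ := eLpNorm_le_eLpNorm_absSum_mul hG (Lp.aestronglyMeasurable x) fun s =>
        (abs_mulVec_le _ _ j).trans
          (mul_le_mul_of_nonneg_left (norm_ofLp_le _) (absSum_nonneg _))

theorem exists_continuousLinearMap_mulVec {F : ℝ → Matrix (Fin n) m ℝ}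
    (hF : EntriesMemLp 2 a b F) (ζ : L2 n a b → ℝ → m → ℝ)
    (hmem : ∀ x j, MemLp (fun s => ζ x s j) ⊤ (volume.restrict (Icc a b)))
    (hadd : ∀ x y, ∀ s ∈ Icc a b, ζ (x + y) s = ζ x s + ζ y s)
    (hsmul : ∀ (c : ℝ) x, ∀ s ∈ Icc a b, ζ (c • x) s = c • ζ x s)
    {C : ENNReal} (hC : C ≠ ⊤) (hbound : ∀ x, ∀ s ∈ Icc a b,
      ‖ζ x s‖ ≤ (C * eLpNorm x 2 (volume.restrict (Icc a b))).toReal) :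
    ∃ T : L2 n a b →L[ℝ] L2 n a b, ∀ x, ∀ᵐ s ∂(volume.restrict (Icc a b)),
      (T x) s = WithLp.toLp 2 ((F s).mulVec (ζ x s)) := by
  refine exists_continuousLinearMap_of_bound (C := C * eLpNorm (fun s => absSum (F s)) 2 _)
    (fun x s => WithLp.toLp 2 ((F s).mulVec (ζ x s))) (fun x => ?_)
    (fun x y => ?_) (fun c x => ?_) (ENNReal.mul_ne_top hC hF.sum_abs.2.ne) (fun x => ?_)
  · exact (memLp_piLp_iff.2 fun i => hF.mulVec (r₂ := ⊤) (r := 2) (hmem x) i).1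
  · filter_upwards [ae_restrict_mem measurableSet_Icc] with s hs
    rw [hadd x y s hs, Pi.add_apply, ← WithLp.toLp_add, ← Matrix.mulVec_add]
  · filter_upwards [ae_restrict_mem measurableSet_Icc] with s hs
    rw [hsmul c x s hs, Pi.smul_apply, ← WithLp.toLp_smul, ← Matrix.mulVec_smul]
  · have hDt := ENNReal.mul_ne_top hC (Lp.memLp x).2.ne
    have h := eLpNorm_le_mul_eLpNorm_of_ae_le_mul
      (c := (C * eLpNorm x 2 (volume.restrict (Icc a b))).toReal)
      (f := fun s => WithLp.toLp 2 ((F s).mulVec (ζ x s)))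
      (g := fun s => absSum (F s)) (μ := volume.restrict (Icc a b)) (by
        filter_upwards [ae_restrict_mem measurableSet_Icc] with s hs
        rw [Real.norm_of_nonneg (absSum_nonneg _), mul_comm]
        exact (norm_toLp_mulVec_le _ _).trans
          (mul_le_mul_of_nonneg_left (hbound x s hs) (absSum_nonneg _))) 2
    rw [ENNReal.ofReal_toReal hDt] at h
    exact h.trans (le_of_eq (mul_right_comm _ _ _))

/-- The upper limit e serves two cases: the identity for ∫_a^s and the constant b for ∫_a^b. Their
difference covers ∫_s^b. -/
theorem exists_integral_operator (hab : a ≤ b) {F : ℝ → Matrix (Fin n) m ℝ}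
    {G : ℝ → Matrix m (Fin n) ℝ} (hF : EntriesMemLp 2 a b F) (hG : EntriesMemLp 2 a b G)
    {e : ℝ → ℝ} (hec : ContinuousOn e (Icc a b)) (he : MapsTo e (Icc a b) (Icc a b)) :
    ∃ T : L2 n a b →L[ℝ] L2 n a b, ∀ x, ∀ᵐ s ∂(volume.restrict (Icc a b)),
      (T x) s = WithLp.toLp 2
        ((F s).mulVec fun j => ∫ t in a..e s, (G t).mulVec (x t).ofLp j) := by
  have hprim : ∀ (x : L2 n a b) j,
      IsPrimitiveOn a b (fun s => ∫ t in a..s, (G t).mulVec (x t).ofLp j)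
        (fun t => (G t).mulVec (x t).ofLp j) := fun x j =>
    IsPrimitiveOn.integral (hG.intervalIntegrable_mulVec hab (memLp_coord x) j)
  refine exists_continuousLinearMap_mulVec hF
    (fun x s j => ∫ t in a..e s, (G t).mulVec (x t).ofLp j)
    (fun x j => memLp_top_of_continuousOn ((hprim x j).continuousOn.comp hec he))
    (fun x y s hs => ?_) (fun c x s hs => ?_) hG.sum_abs.2.ne
    (fun x s hs => norm_integral_mulVec_le hG x (he hs))
  · funext j
    rw [Pi.add_apply, ← intervalIntegral.integral_add ((hprim x j).intervalIntegrable_of_mem (he hs))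
      ((hprim y j).intervalIntegrable_of_mem (he hs))]
    refine intervalIntegral.integral_congr_ae ?_
    filter_upwards [(ae_restrict_iff' measurableSet_Icc).1 (Lp.coeFn_add x y)] with t ht htm
    rw [uIoc_of_le (he hs).1] at htm
    rw [ht ⟨htm.1.le, htm.2.trans (he hs).2⟩, Pi.add_apply, WithLp.ofLp_add, Matrix.mulVec_add,
      Pi.add_apply]
  · funext j
    rw [Pi.smul_apply, smul_eq_mul, ← intervalIntegral.integral_const_mul]
    refine intervalIntegral.integral_congr_ae ?_
    filter_upwards [(ae_restrict_iff' measurableSet_Icc).1 (Lp.coeFn_smul c x)] with t ht htm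
    rw [uIoc_of_le (he hs).1] at htm
    rw [ht ⟨htm.1.le, htm.2.trans (he hs).2⟩, Pi.smul_apply, WithLp.ofLp_smul, Matrix.mulVec_smul,
      Pi.smul_apply, smul_eq_mul]

theorem integral_toLp_mulVec {c d : ℝ} (M : Matrix (Fin n) m ℝ) {g : ℝ → m → ℝ}
    (hg : ∀ j, IntervalIntegrable (fun t => g t j) volume c d) :
    IntervalIntegrable (fun t => WithLp.toLp 2 (M.mulVec (g t))) volume c d ∧
      ∫ t in c..d, WithLp.toLp 2 (M.mulVec (g t)) =
        WithLp.toLp 2 (M.mulVec fun j => ∫ t in c..d, g t j) := by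
  have hcoord : ∀ i, IntervalIntegrable (fun t => M.mulVec (g t) i) volume c d := fun i => by
    simp only [Matrix.mulVec, dotProduct]
    exact intervalIntegrable_finset_sum _ fun j _ => (hg j).const_mul _
  have hI : IntervalIntegrable (fun t => WithLp.toLp 2 (M.mulVec (g t))) volume c d := by
    rw [intervalIntegrable_iff]
    exact integrable_piLp_iff.2 fun i => intervalIntegrable_iff.1 (hcoord i)
  refine ⟨hI, ?_⟩
  ext i
  have h := (EuclideanSpace.proj (𝕜 := ℝ) (ι := Fin n) i).intervalIntegral_comp_comm hI
  refine h.symm.trans ?_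
  change ∫ t in c..d, ∑ j, M i j * g t j = ∑ j, M i j * ∫ t in c..d, g t j
  rw [intervalIntegral.integral_finsetSum fun j _ => (hg j).const_mul _]
  simp

/-- A 3-PI operator with bounded multiplier and separable square-integrable kernels is bounded. -/
theorem exists_isThreePI_of_separable (hab : a ≤ b) {R₀ : ℝ → Matrix (Fin n) (Fin n) ℝ}
    {R₁ R₂ : ℝ → ℝ → Matrix (Fin n) (Fin n) ℝ} (hR₀ : EntriesMemLp ⊤ a b R₀)
    {C₁ : ℝ → Matrix (Fin n) m₁ ℝ} {D₁ : ℝ → Matrix m₁ (Fin n) ℝ}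
    {C₂ : ℝ → Matrix (Fin n) m₂ ℝ} {D₂ : ℝ → Matrix m₂ (Fin n) ℝ}
    (hC₁ : EntriesMemLp 2 a b C₁) (hD₁ : EntriesMemLp 2 a b D₁)
    (hC₂ : EntriesMemLp 2 a b C₂) (hD₂ : EntriesMemLp 2 a b D₂)
    (h₁ : ∀ s ∈ Icc a b, ∀ θ ∈ Icc a b, R₁ s θ = C₁ s * D₁ θ)
    (h₂ : ∀ s ∈ Icc a b, ∀ θ ∈ Icc a b, R₂ s θ = C₂ s * D₂ θ) :
    ∃ T : L2 n a b →L[ℝ] L2 n a b, IsThreePI R₀ R₁ R₂ T ∧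
      ∀ x, ∀ᵐ s ∂(volume.restrict (Icc a b)), ((T x) s).ofLp = (R₀ s).mulVec (x s).ofLp
        + (C₁ s).mulVec (fun j => ∫ t in a..s, (D₁ t).mulVec (x t).ofLp j)
        + (C₂ s).mulVec (fun j => ∫ t in s..b, (D₂ t).mulVec (x t).ofLp j) := by
  obtain ⟨M, hM⟩ := exists_multiplication hR₀
  obtain ⟨J₁, hJ₁⟩ := exists_integral_operator hab hC₁ hD₁ continuousOn_id (mapsTo_id _)
  obtain ⟨J₂, hJ₂⟩ := exists_integral_operator hab hC₂ hD₂ continuousOn_id (mapsTo_id _)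
  obtain ⟨J₃, hJ₃⟩ := exists_integral_operator hab hC₂ hD₂ (e := fun _ => b) continuousOn_const
    (fun _ _ => right_mem_Icc.2 hab)
  have hform : ∀ x, ∀ᵐ s ∂(volume.restrict (Icc a b)),
      ((M + J₁ + (J₃ - J₂)) x) s = act (R₀ s) (x s)
        + WithLp.toLp 2 ((C₁ s).mulVec (fun j => ∫ t in a..s, (D₁ t).mulVec (x t).ofLp j))
        + WithLp.toLp 2 ((C₂ s).mulVec (fun j => ∫ t in s..b, (D₂ t).mulVec (x t).ofLp j)) := by
    intro x
    filter_upwards [hM x, hJ₁ x, hJ₂ x, hJ₃ x, Lp.coeFn_add (M x + J₁ x) (J₃ x - J₂ x),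
      Lp.coeFn_add (M x) (J₁ x), Lp.coeFn_sub (J₃ x) (J₂ x), ae_restrict_mem measurableSet_Icc]
      with s h1 h2 h3 h4 h5 h6 h7 hs
    have h8 : (fun j => ∫ t in s..b, (D₂ t).mulVec (x t).ofLp j) =
        (fun j => ∫ t in a..b, (D₂ t).mulVec (x t).ofLp j)
          - fun j => ∫ t in a..s, (D₂ t).mulVec (x t).ofLp j := by
      funext j
      exact integral_right_eq (hD₂.intervalIntegrable_mulVec hab (memLp_coord x) j) hs
    rw [_root_.add_apply, _root_.add_apply,
      _root_.sub_apply, h5, Pi.add_apply, h6, Pi.add_apply, h7, Pi.sub_apply,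
      h1, h2, h3, h4, h8, Matrix.mulVec_sub, WithLp.toLp_sub]
    rfl
  refine ⟨M + J₁ + (J₃ - J₂), fun x => ?_, fun x => ?_⟩
  · filter_upwards [hform x, ae_restrict_mem measurableSet_Icc] with s hs hsm
    have hi₁ : ∀ j, IntervalIntegrable (fun t => (D₁ t).mulVec (x t).ofLp j) volume a s :=
      fun j => (IsPrimitiveOn.integral
        (hD₁.intervalIntegrable_mulVec hab (memLp_coord x) j)).intervalIntegrable_of_mem hsm
    have hi₂ : ∀ j, IntervalIntegrable (fun t => (D₂ t).mulVec (x t).ofLp j) volume s b :=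
      fun j => (hD₂.intervalIntegrable_mulVec hab (memLp_coord x) j).mono_set (by
        rw [uIcc_of_le hsm.2, uIcc_of_le hab]; exact Icc_subset_Icc_left hsm.1)
    have k₁ := integral_toLp_mulVec (C₁ s) hi₁
    have k₂ := integral_toLp_mulVec (C₂ s) hi₂
    have e₁ : EqOn (fun θ => WithLp.toLp 2 ((C₁ s).mulVec ((D₁ θ).mulVec (x θ).ofLp)))
        (fun θ => act (R₁ s θ) (x θ)) (uIcc a s) := fun θ hθ => by
      rw [uIcc_of_le hsm.1] at hθ
      simp only [act, h₁ s hsm θ ⟨hθ.1, hθ.2.trans hsm.2⟩, Matrix.mulVec_mulVec]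
    have e₂ : EqOn (fun θ => WithLp.toLp 2 ((C₂ s).mulVec ((D₂ θ).mulVec (x θ).ofLp)))
        (fun θ => act (R₂ s θ) (x θ)) (uIcc s b) := fun θ hθ => by
      rw [uIcc_of_le hsm.2] at hθ
      simp only [act, h₂ s hsm θ ⟨hsm.1.trans hθ.1, hθ.2⟩, Matrix.mulVec_mulVec]
    refine ⟨k₁.1.congr (e₁.mono uIoc_subset_uIcc), k₂.1.congr (e₂.mono uIoc_subset_uIcc), ?_⟩
    rw [hs, ← k₁.2, ← k₂.2, intervalIntegral.integral_congr e₁, intervalIntegral.integral_congr e₂]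
  · filter_upwards [hform x] with s hs
    rw [hs]
    rfl

end SeparableKernels

end ThreePI

namespace ThreePI

/-! ### The 3-PI operator, its inverse and its kernel. -/

section Inversion

variable {n p q : ℕ} {a b : ℝ} {R₀ : ℝ → Matrix (Fin n) (Fin n) ℝ}
  {R₁ R₂ : ℝ → ℝ → Matrix (Fin n) (Fin n) ℝ} {F₁ : ℝ → Matrix (Fin n) (Fin p) ℝ}
  {G₁ : ℝ → Matrix (Fin p) (Fin n) ℝ} {F₂ : ℝ → Matrix (Fin n) (Fin q) ℝ}
  {G₂ : ℝ → Matrix (Fin q) (Fin n) ℝ}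
  {U V : ℝ → Matrix (Fin p ⊕ Fin q) (Fin p ⊕ Fin q) ℝ}

/-- Makes the state independent of the chosen representative of an L² class. -/
theorem state_congr_ae {x y : ℝ → Fin n → ℝ}
    (h : ∀ᵐ t ∂(volume.restrict (Icc a b)), x t = y t) {s : ℝ} (hs : s ∈ Icc a b) :
    state a b G₁ G₂ x s = state a b G₁ G₂ y s := by
  have h' := (ae_restrict_iff' measurableSet_Icc).1 h
  funext i
  rcases i with i | j
  · refine intervalIntegral.integral_congr_ae ?_
    filter_upwards [h'] with t ht htm
    rw [uIoc_of_le hs.1] at htm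
    rw [ht ⟨htm.1.le, htm.2.trans hs.2⟩]
  · refine intervalIntegral.integral_congr_ae ?_
    filter_upwards [h'] with t ht htm
    rw [uIoc_of_le hs.2] at htm
    rw [ht ⟨hs.1.trans htm.1.le, htm.2⟩]

theorem rowF_mulVec_state (s : ℝ) (x : ℝ → Fin n → ℝ) :
    (rowF F₁ F₂ s).mulVec (state a b G₁ G₂ x s) =
      (F₁ s).mulVec (fun i => ∫ t in a..s, (G₁ t).mulVec (x t) i)
        + (F₂ s).mulVec (fun j => ∫ t in s..b, (G₂ t).mulVec (x t) j) := by
  rw [rowF, Matrix.fromCols_mulVec]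
  rfl

theorem exists_isThreePI_of_factorization (hab : a ≤ b) (hR₀ : EntriesMemLp ⊤ a b R₀)
    (hR₀unit : ∀ s ∈ Icc a b, IsUnit (R₀ s))
    (hF₁ : EntriesMemLp 2 a b F₁) (hG₁ : EntriesMemLp 2 a b G₁)
    (hF₂ : EntriesMemLp 2 a b F₂) (hG₂ : EntriesMemLp 2 a b G₂)
    (hfac₁ : ∀ s ∈ Icc a b, ∀ θ ∈ Icc a b, (R₀ s)⁻¹ * R₁ s θ = -(F₁ s * G₁ θ))
    (hfac₂ : ∀ s ∈ Icc a b, ∀ θ ∈ Icc a b, (R₀ s)⁻¹ * R₂ s θ = -(F₂ s * G₂ θ)) :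
    ∃ T : L2 n a b →L[ℝ] L2 n a b, IsThreePI R₀ R₁ R₂ T ∧
      ∀ x, ∀ᵐ s ∂(volume.restrict (Icc a b)), ((T x) s).ofLp = (R₀ s).mulVec
        ((x s).ofLp - (rowF F₁ F₂ s).mulVec (state a b G₁ G₂ (fun t => (x t).ofLp) s)) := by
  -- Multiplying the factorization by R₀(s) shows that R₁ and R₂ are themselves separable.
  have hfac : ∀ {r : ℕ} {R : ℝ → ℝ → Matrix (Fin n) (Fin n) ℝ} {F : ℝ → Matrix (Fin n) (Fin r) ℝ}
      {G : ℝ → Matrix (Fin r) (Fin n) ℝ},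
      (∀ s ∈ Icc a b, ∀ θ ∈ Icc a b, (R₀ s)⁻¹ * R s θ = -(F s * G θ)) →
      ∀ s ∈ Icc a b, ∀ θ ∈ Icc a b, R s θ = -(R₀ s * F s) * G θ := by
    intro r R F G h s hs θ hθ
    have hdet := (Matrix.isUnit_iff_isUnit_det _).1 (hR₀unit s hs)
    rw [Matrix.neg_mul, Matrix.mul_assoc, ← Matrix.mul_neg, ← h s hs θ hθ,
      Matrix.mul_nonsing_inv_cancel_left _ _ hdet]
  obtain ⟨T, hT, hTx⟩ := exists_isThreePI_of_separable hab hR₀ (hR₀.mul hF₁ (r := 2)).neg hG₁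
    (hR₀.mul hF₂ (r := 2)).neg hG₂ (hfac hfac₁) (hfac hfac₂)
  refine ⟨T, hT, fun x => ?_⟩
  filter_upwards [hTx x] with s hs
  rw [hs, rowF_mulVec_state, Matrix.mulVec_sub, Matrix.mulVec_add, Matrix.mulVec_mulVec,
    Matrix.mulVec_mulVec, Matrix.neg_mulVec, Matrix.neg_mulVec]
  abel

theorem exists_isThreePI_inverse_kernel (hab : a ≤ b)
    (hR₀inv : EntriesMemLp ⊤ a b (fun s => (R₀ s)⁻¹))
    (hF₁ : EntriesMemLp 2 a b F₁) (hG₁ : EntriesMemLp 2 a b G₁)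
    (hF₂ : EntriesMemLp 2 a b F₂) (hG₂ : EntriesMemLp 2 a b G₂)
    (hU : IsFundamental a b (coeff F₁ G₁ F₂ G₂) U)
    (hV : IsAdjointFundamental a b (coeff F₁ G₁ F₂ G₂) V) :
    ∃ S : L2 n a b →L[ℝ] L2 n a b,
      IsThreePI (fun s => (R₀ s)⁻¹) (fun s θ => kerL₁ b F₁ G₁ F₂ G₂ U V s θ * (R₀ θ)⁻¹)
        (fun s θ => kerL₂ b F₁ G₁ F₂ G₂ U V s θ * (R₀ θ)⁻¹) S ∧
      ∀ f, ∀ᵐ s ∂(volume.restrict (Icc a b)), ((S f) s).ofLp =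
        (R₀ s)⁻¹.mulVec (f s).ofLp + (rowF F₁ F₂ s).mulVec ((U s).mulVec
          (-(projP (U b)).mulVec (fun i => ∫ t in a..b,
              (V t).mulVec ((colG G₁ G₂ t).mulVec ((R₀ t)⁻¹.mulVec (f t).ofLp)) i)
            + fun i => ∫ t in a..s,
              (V t).mulVec ((colG G₁ G₂ t).mulVec ((R₀ t)⁻¹.mulVec (f t).ofLp)) i)) := by
  have hFU := hU.entriesMemLp_rowF_mul hab hF₁ hF₂
  have hVGR : EntriesMemLp 2 a b (fun t => V t * colG G₁ G₂ t * (R₀ t)⁻¹) :=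
    (hV.entriesMemLp_mul_colG hab hG₁ hG₂).mul hR₀inv
  -- Both kernels share the right factor V B R₀⁻¹; the left factors are F U (I - P) for L₁ and -F U
  -- P for L₂.
  have hC₁ : EntriesMemLp 2 a b (fun s => rowF F₁ F₂ s * U s * (1 - projP (U b))) :=
    hFU.mul (r₂ := ⊤) (EntriesMemLp.const _)
  have hC₂ : EntriesMemLp 2 a b (fun s => -(rowF F₁ F₂ s * U s * projP (U b))) :=
    (hFU.mul (r₂ := ⊤) (r := 2) (EntriesMemLp.const _)).neg
  obtain ⟨S, hS, hSf⟩ := exists_isThreePI_of_separable hab hR₀inv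
    (R₁ := fun s θ => kerL₁ b F₁ G₁ F₂ G₂ U V s θ * (R₀ θ)⁻¹)
    (R₂ := fun s θ => kerL₂ b F₁ G₁ F₂ G₂ U V s θ * (R₀ θ)⁻¹) hC₁ hVGR hC₂ hVGR
    (fun s _ θ _ => by
      simp only [kerL₁, kerL₂, Matrix.mul_add, Matrix.mul_neg, Matrix.one_mul, Matrix.add_mul,
        Matrix.neg_mul, Matrix.mul_assoc, sub_eq_add_neg])
    (fun s _ θ _ => by simp only [kerL₂, Matrix.neg_mul, Matrix.mul_assoc])
  refine ⟨S, hS, fun f => ?_⟩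
  filter_upwards [hSf f, ae_restrict_mem measurableSet_Icc] with s hs hsm
  have hsplit : (fun i => ∫ t in s..b, (V t * colG G₁ G₂ t * (R₀ t)⁻¹).mulVec (f t).ofLp i) =
      (fun i => ∫ t in a..b, (V t * colG G₁ G₂ t * (R₀ t)⁻¹).mulVec (f t).ofLp i)
        - fun i => ∫ t in a..s, (V t * colG G₁ G₂ t * (R₀ t)⁻¹).mulVec (f t).ofLp i := by
    funext i
    exact integral_right_eq (hVGR.intervalIntegrable_mulVec hab (memLp_coord f) i) hsm
  rw [hs, hsplit]
  simp only [Matrix.mulVec_mulVec, Matrix.mulVec_add, Matrix.mulVec_sub, Matrix.mulVec_neg,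
    Matrix.mul_sub, Matrix.sub_mulVec, Matrix.neg_mulVec, Matrix.mul_one, Matrix.mul_assoc]
  abel

/-- If U₂₂(b) were singular, the nontrivial solution of x = F · state x would be a nonzero L² class
killed by T. -/
theorem isUnit_toBlocks₂₂_of_isUnit (hab : a ≤ b)
    (hF₁ : EntriesMemLp 2 a b F₁) (hG₁ : EntriesMemLp 2 a b G₁)
    (hF₂ : EntriesMemLp 2 a b F₂) (hG₂ : EntriesMemLp 2 a b G₂)
    (hU : IsFundamental a b (coeff F₁ G₁ F₂ G₂) U) {T : L2 n a b →L[ℝ] L2 n a b}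
    (hT : ∀ x, ∀ᵐ s ∂(volume.restrict (Icc a b)), ((T x) s).ofLp = (R₀ s).mulVec
      ((x s).ofLp - (rowF F₁ F₂ s).mulVec (state a b G₁ G₂ (fun t => (x t).ofLp) s)))
    (hTu : IsUnit T) : IsUnit (U b).toBlocks₂₂ := by
  by_contra hUb
  obtain ⟨x, hx, hxs, hx0⟩ := exists_eq_state_of_not_isUnit hab hF₁ hG₁ hF₂ hG₂ hU hUb
  have hmem : MemLp (fun s => WithLp.toLp 2 (x s)) 2 (volume.restrict (Icc a b)) :=
    memLp_piLp_iff.2 hx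
  set X : L2 n a b := hmem.toLp _
  have hX : ∀ᵐ s ∂(volume.restrict (Icc a b)), (X s).ofLp = x s := by
    filter_upwards [hmem.coeFn_toLp] with s hs
    rw [hs]
  have hTX : T X = 0 := by
    rw [Lp.eq_zero_iff_ae_eq_zero]
    filter_upwards [hT X, hX, ae_restrict_mem measurableSet_Icc] with s h1 h2 hs
    rw [state_congr_ae hX hs, h2, ← hxs s hs, sub_self, Matrix.mulVec_zero] at h1
    exact congrArg (WithLp.toLp 2) h1
  obtain ⟨T', rfl⟩ := hTu
  have hX0 : X = 0 := by
    have h : ((↑T'⁻¹ * ↑T' : L2 n a b →L[ℝ] L2 n a b)) X = 0 := by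
      rw [mul_apply_eq_comp, hTX, map_zero]
    simpa using h
  apply hx0
  filter_upwards [hX, Lp.eq_zero_iff_ae_eq_zero.1 hX0] with s h1 h2
  rw [← h1, h2]
  rfl

end Inversion

end ThreePI

theorem mainTheorem12 {n p q : ℕ} {a b : ℝ} (hab : a ≤ b)
    (R₀ : ℝ → Matrix (Fin n) (Fin n) ℝ) (R₁ R₂ : ℝ → ℝ → Matrix (Fin n) (Fin n) ℝ)
    (hR₀ : ThreePI.EntriesMemLp ⊤ a b R₀)
    (hR₀unit : ∀ s ∈ Set.Icc a b, IsUnit (R₀ s))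
    (hR₀inv : ThreePI.EntriesMemLp ⊤ a b (fun s => (R₀ s)⁻¹))
    (F₁ : ℝ → Matrix (Fin n) (Fin p) ℝ) (G₁ : ℝ → Matrix (Fin p) (Fin n) ℝ)
    (F₂ : ℝ → Matrix (Fin n) (Fin q) ℝ) (G₂ : ℝ → Matrix (Fin q) (Fin n) ℝ)
    (hF₁ : ThreePI.EntriesMemLp 2 a b F₁) (hG₁ : ThreePI.EntriesMemLp 2 a b G₁)
    (hF₂ : ThreePI.EntriesMemLp 2 a b F₂) (hG₂ : ThreePI.EntriesMemLp 2 a b G₂)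
    (hfac₁ : ∀ s ∈ Set.Icc a b, ∀ θ ∈ Set.Icc a b, (R₀ s)⁻¹ * R₁ s θ = -(F₁ s * G₁ θ))
    (hfac₂ : ∀ s ∈ Set.Icc a b, ∀ θ ∈ Set.Icc a b, (R₀ s)⁻¹ * R₂ s θ = -(F₂ s * G₂ θ)) :
    -- existence and uniqueness on `[a,b]` of `U` and of `V`
    (∃ U, ThreePI.IsFundamental a b (ThreePI.coeff F₁ G₁ F₂ G₂) U ∧
      ∀ U', ThreePI.IsFundamental a b (ThreePI.coeff F₁ G₁ F₂ G₂) U' →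
        Set.EqOn U' U (Set.Icc a b)) ∧
    (∃ V, ThreePI.IsAdjointFundamental a b (ThreePI.coeff F₁ G₁ F₂ G₂) V ∧
      ∀ V', ThreePI.IsAdjointFundamental a b (ThreePI.coeff F₁ G₁ F₂ G₂) V' →
        Set.EqOn V' V (Set.Icc a b)) ∧
    -- invertibility criterion and formula for the inverse
    ∀ U V, ThreePI.IsFundamental a b (ThreePI.coeff F₁ G₁ F₂ G₂) U →
      ThreePI.IsAdjointFundamental a b (ThreePI.coeff F₁ G₁ F₂ G₂) V →
      ∃ T : ThreePI.L2 n a b →L[ℝ] ThreePI.L2 n a b,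
        ThreePI.IsThreePI R₀ R₁ R₂ T ∧
        (IsUnit T ↔ IsUnit (U b).toBlocks₂₂) ∧
        (IsUnit (U b).toBlocks₂₂ →
          ∃ S : ThreePI.L2 n a b →L[ℝ] ThreePI.L2 n a b,
            ThreePI.IsThreePI (fun s => (R₀ s)⁻¹)
              (fun s θ => ThreePI.kerL₁ b F₁ G₁ F₂ G₂ U V s θ * (R₀ θ)⁻¹)
              (fun s θ => ThreePI.kerL₂ b F₁ G₁ F₂ G₂ U V s θ * (R₀ θ)⁻¹) S ∧
            T.comp S = ContinuousLinearMap.id ℝ (ThreePI.L2 n a b) ∧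
            S.comp T = ContinuousLinearMap.id ℝ (ThreePI.L2 n a b)) := by
  obtain ⟨U₀, hU₀⟩ := ThreePI.exists_isFundamental hab
    (ThreePI.intervalIntegrable_coeff hab hF₁ hG₁ hF₂ hG₂)
  obtain ⟨V₀, hV₀⟩ := ThreePI.exists_isAdjointFundamental hab
    (ThreePI.intervalIntegrable_coeff hab hF₁ hG₁ hF₂ hG₂)
  refine ⟨⟨U₀, hU₀, fun U' hU' => hU₀.eqOn hab hU' hV₀⟩,
    ⟨V₀, hV₀, fun V' hV' => hV₀.eqOn hab hV' hU₀⟩, fun U V hU hV => ?_⟩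
  obtain ⟨T, hT, hTx⟩ := ThreePI.exists_isThreePI_of_factorization hab hR₀ hR₀unit hF₁ hG₁ hF₂ hG₂
    hfac₁ hfac₂
  have hinv : IsUnit (U b).toBlocks₂₂ →
      ∃ S : ThreePI.L2 n a b →L[ℝ] ThreePI.L2 n a b,
        ThreePI.IsThreePI (fun s => (R₀ s)⁻¹)
          (fun s θ => ThreePI.kerL₁ b F₁ G₁ F₂ G₂ U V s θ * (R₀ θ)⁻¹)
          (fun s θ => ThreePI.kerL₂ b F₁ G₁ F₂ G₂ U V s θ * (R₀ θ)⁻¹) S ∧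
        T.comp S = ContinuousLinearMap.id ℝ (ThreePI.L2 n a b) ∧
        S.comp T = ContinuousLinearMap.id ℝ (ThreePI.L2 n a b) := by
    intro hUb
    obtain ⟨S, hS, hSf⟩ := ThreePI.exists_isThreePI_inverse_kernel hab hR₀inv hF₁ hG₁ hF₂ hG₂ hU hV
    have hy : ∀ (f : ThreePI.L2 n a b) k, MemLp (fun s => (R₀ s)⁻¹.mulVec (f s).ofLp k) 2
        (volume.restrict (Icc a b)) := fun f k =>
      hR₀inv.mulVec (r₂ := 2) (r := 2) (ThreePI.memLp_coord f) k
    -- With y = R₀⁻¹ f, the left side says T x = f and the right side says x = S f. Taking x = S f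
    -- yields T S = 1, and f = T x yields S T = 1.
    have hiff := fun x f : ThreePI.L2 n a b =>
      ThreePI.eq_sub_state_iff hab hG₁ hG₂ hU hV hUb (ThreePI.memLp_coord x) (hy f)
    refine ⟨S, hS, ContinuousLinearMap.ext fun f => Lp.ext ?_,
      ContinuousLinearMap.ext fun x => Lp.ext ?_⟩
    · have h := (hiff (S f) f).2 (hSf f)
      filter_upwards [h, hTx (S f), ae_restrict_mem measurableSet_Icc] with s h1 h2 hs
      have hdet := (Matrix.isUnit_iff_isUnit_det _).1 (hR₀unit s hs)
      rw [← h1, Matrix.mulVec_mulVec, Matrix.mul_nonsing_inv _ hdet, Matrix.one_mulVec] at h2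
      exact congrArg (WithLp.toLp 2) h2
    · have h := (hiff x (T x)).1 (by
        filter_upwards [hTx x, ae_restrict_mem measurableSet_Icc] with s h1 hs
        have hdet := (Matrix.isUnit_iff_isUnit_det _).1 (hR₀unit s hs)
        rw [h1, Matrix.mulVec_mulVec, Matrix.nonsing_inv_mul _ hdet, Matrix.one_mulVec])
      filter_upwards [h, hSf (T x)] with s h1 h2
      exact congrArg (WithLp.toLp 2) (h2.trans h1.symm)
  refine ⟨T, hT, ⟨ThreePI.isUnit_toBlocks₂₂_of_isUnit hab hF₁ hG₁ hF₂ hG₂ hU hTx, fun hUb => ?_⟩,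
    hinv⟩
  obtain ⟨S, -, hTS, hST⟩ := hinv hUb
  exact ⟨⟨T, S, hTS, hST⟩, rfl⟩
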